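/- All graphs are finite and simple. A graph is \emph{outerplanar} if it can be drawn in the plane $\mathbb{R}^2$ without crossings (vertices are distinct points, edges are simple arcs joining their ends, no arc contains a vertex other than its ends, and two arcs meet only in common ends) so that every vertex lies on the boundary of the outer (unbounded) face. \textbf{Theorem.} Every $n$-vertex outerplanar graph $G$ contains an independent set $I$ and a collection $\mathcal{C}$ of pairwise vertex-disjoint cycles such that \[ 9|I| \ge 4n - 3|\mathcal{C}|. \] The bound is tight: for every integer $k\ge 0$ the disjoint union of $k$ triangles, which has $n=3k$ vertices, is outerplanar, and every independent set $I$ and every collection $\mathcal{C}$ of pairwise vertex-disjoint cycles in it satisfy $9|I| \le 4n - 3|\mathcal{C}|$. -/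

import Mathlib

namespace SimpleGraph

/-- A drawing of `G` in the plane `ℝ²` without crossings: vertices are distinct points, each edge
`uv` is a simple arc joining the points of `u` and `v`, an arc contains no vertex other than its
two ends, and the arcs of two distinct edges meet only in common ends.
The values of `arc` outside `G.edgeSet` are irrelevant. -/
structure PlaneDrawing {V : Type*} (G : SimpleGraph V) where
  point : V → ℝ × ℝ
  arc : Sym2 V → Set (ℝ × ℝ)
  point_injective : Function.Injective point
  isArc : ∀ u v : V, G.Adj u v →
    ∃ γ : _root_.Path (point u) (point v), Function.Injective γ ∧ Set.range γ = arc s(u, v)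
  mem_of_point_mem_arc : ∀ e ∈ G.edgeSet, ∀ w : V, point w ∈ arc e → w ∈ e
  arc_inter_arc : ∀ e ∈ G.edgeSet, ∀ f ∈ G.edgeSet, e ≠ f →
    ∀ z ∈ arc e ∩ arc f, ∃ w : V, w ∈ e ∧ w ∈ f ∧ z = point w

/-- The set of all points of the plane covered by the drawing. -/
def PlaneDrawing.carrier {V : Type*} {G : SimpleGraph V} (D : G.PlaneDrawing) : Set (ℝ × ℝ) :=
  Set.range D.point ∪ ⋃ e ∈ G.edgeSet, D.arc e

/-- The outer face of the drawing: the points off the drawing whose connected component in the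
complement of the drawing is unbounded. (For a finite graph the carrier is compact, so there is
exactly one unbounded component.) -/
def PlaneDrawing.outerFace {V : Type*} {G : SimpleGraph V} (D : G.PlaneDrawing) : Set (ℝ × ℝ) :=
  {z | z ∈ D.carrierᶜ ∧ ¬ Bornology.IsBounded (connectedComponentIn D.carrierᶜ z)}

/-- `G` is outerplanar: it has a crossing-free drawing in the plane with every vertex on the
boundary of the outer face. -/
def IsOuterplanar {V : Type*} (G : SimpleGraph V) : Prop :=
  ∃ D : G.PlaneDrawing, ∀ v : V, D.point v ∈ frontier D.outerFace

/-- `C` is a collection of pairwise vertex-disjoint cycles of `G`, each given as a subgraph. -/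
def IsDisjointCycleCollection {V : Type*} (G : SimpleGraph V) (C : Finset G.Subgraph) : Prop :=
  (∀ H ∈ C, ∃ (v : V) (p : G.Walk v v), p.IsCycle ∧ p.toSubgraph = H) ∧
    (C : Set G.Subgraph).PairwiseDisjoint Subgraph.verts

/-- The disjoint union of `k` triangles. -/
def disjointTriangles (k : ℕ) : SimpleGraph (Fin k × Fin 3) where
  Adj x y := x.1 = y.1 ∧ x.2 ≠ y.2
  symm := ⟨fun _ _ h => ⟨h.1.symm, h.2.symm⟩⟩
  loopless := ⟨fun _ h => h.2 rfl⟩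

end SimpleGraph

/-! The induction runs over graphs whose cone (the graph plus an apex joined to every vertex) has a
weak drawing: only vertex-disjoint edges must have disjoint images. An outerplanar drawing yields
one, with the apex in the outer face, and the weak notion survives deleting vertices and replacing a
path by an edge.

Such a graph has no K₂₃ or K₄ minor, as the apex would complete it to a weakly drawn K₃₃ or K₅.
These are excluded by winding numbers. For disjoint paths γ and δ the map (s, t) ↦ γ(s) - δ(t) never
vanishes, so its logarithm has zero total change round the unit square. This gives one integer
relation per pair of disjoint edges (`exists_int_of_disjoint_paths`), and for K₃₃ and K₅ the
relations are inconsistent modulo 2.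

Without these minors, minimum degree two forces a triangle with a vertex of degree two, or two
adjacent vertices of degree two (`exists_reducible`). Hence there are three reductions, each adding
one vertex to I (`exists_indepSet_and_cores`): a vertex of degree at most one is deleted with its
neighbour, costing at most 4·2 ≤ 9; a triangle with a vertex of degree two is deleted and counted as
a cycle, 4·3 = 9 + 3; a path x u v y through vertices u, v of degree two becomes an edge x y,
costing 4·2 ≤ 9. The new edge keeps x or y out of I, so u or v can be added.

For k triangles, |I| ≤ k and |C| ≤ k, which gives tightness. -/

namespace Complex

/-! ### Continuous logarithms, and nonplanarity of K₃₃ and K₅. -/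

/-- The total change over `[0, 1]` of a continuous logarithm of `f`. -/
noncomputable def logChange (f : ℝ → ℂ) : ℂ :=
  open Classical in
  if h : ∃ L : ℝ → ℂ, Continuous L ∧ ∀ t, exp (L t) = f t then h.choose 1 - h.choose 0 else 0

/-- A continuous nowhere vanishing function on a simply connected, locally path connected space
has a continuous logarithm. -/
theorem exists_continuous_log {A : Type*} [TopologicalSpace A] [SimplyConnectedSpace A]
    [LocallyPathConnectedSpace A] {f : A → ℂ} (hf : Continuous f) (h0 : ∀ a, f a ≠ 0) :
    ∃ L : A → ℂ, Continuous L ∧ ∀ a, exp (L a) = f a := by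
  obtain ⟨a₀⟩ : Nonempty A := inferInstance
  obtain ⟨F, ⟨-, hF⟩, -⟩ := isCoveringMapOn_exp.existsUnique_continuousMap_lifts
    (⟨f, hf⟩ : C(A, ℂ)) (a₀ := a₀) (e₀ := log (f a₀)) (by simp [exp_log (h0 a₀)])
    (fun a => by simpa using h0 a)
  exact ⟨F, F.continuous, fun a => congrFun hF a⟩

/-- Two continuous logarithms differ by a continuous function with values in the discrete set 2πiℤ,
hence by a constant. This makes `logChange` independent of the chosen logarithm. -/
theorem sub_eq_sub_of_exp_eq {L M : ℝ → ℂ} (hL : Continuous L) (hM : Continuous M)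
    (h : ∀ t, exp (L t) = exp (M t)) (s t : ℝ) : L s - M s = L t - M t := by
  choose n hn using fun t => exp_eq_exp_iff_exists_int.1 (h t)
  have hpi : (2 * (Real.pi : ℂ) * I) ≠ 0 := two_pi_I_ne_zero
  have hn' : ∀ t, (n t : ℝ) = ((L t - M t) / (2 * Real.pi * I)).re := fun t => by
    have : (L t - M t) / (2 * Real.pi * I) = ((n t : ℝ) : ℂ) := by
      rw [hn t, add_sub_cancel_left, mul_div_assoc, div_self hpi]; simp
    rw [this, ofReal_re]
  have hc : Continuous n := by
    rw [Int.isClosedEmbedding_coe_real.isEmbedding.continuous_iff]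
    have : ((fun m : ℤ => (m : ℝ)) ∘ n) = fun t => ((L t - M t) / (2 * Real.pi * I)).re :=
      funext hn'
    rw [this]
    fun_prop
  have := PreconnectedSpace.constant inferInstance hc (x := s) (y := t)
  rw [hn s, hn t, this]; ring

theorem logChange_eq {f L : ℝ → ℂ} (hL : Continuous L) (h : ∀ t, exp (L t) = f t) :
    logChange f = L 1 - L 0 := by
  have hex : ∃ L : ℝ → ℂ, Continuous L ∧ ∀ t, exp (L t) = f t := ⟨L, hL, h⟩
  rw [logChange, dif_pos hex]
  have := sub_eq_sub_of_exp_eq hex.choose_spec.1 hL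
    (fun t => (hex.choose_spec.2 t).trans (h t).symm) 0 1
  linear_combination -this

theorem exp_logChange {f : ℝ → ℂ} (hf : Continuous f) (h0 : ∀ t, f t ≠ 0) :
    exp (logChange f) = f 1 / f 0 := by
  obtain ⟨L, hL, h⟩ := exists_continuous_log hf h0
  rw [logChange_eq hL h, exp_sub, h, h]

theorem logChange_neg {f : ℝ → ℂ} (hf : Continuous f) (h0 : ∀ t, f t ≠ 0) :
    logChange (fun t => -f t) = logChange f := by
  obtain ⟨L, hL, h⟩ := exists_continuous_log hf h0
  rw [logChange_eq hL h, logChange_eq (L := fun t => L t + Real.pi * I) (by fun_prop)]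
  · ring
  · intro t; rw [exp_add, exp_pi_mul_I, h]; ring

/-- The plane is simply connected, so F has one logarithm defined everywhere; both sides are its
difference between opposite corners of the unit square. -/
theorem logChange_square {F : ℝ × ℝ → ℂ} (hF : Continuous F) (h0 : ∀ z, F z ≠ 0) :
    logChange (fun s => F (s, 0)) + logChange (fun t => F (1, t)) =
      logChange (fun t => F (0, t)) + logChange (fun s => F (s, 1)) := by
  obtain ⟨L, hL, h⟩ := exists_continuous_log hF h0
  rw [logChange_eq (L := fun s => L (s, 0)) (by fun_prop) (fun s => h _),
    logChange_eq (L := fun t => L (1, t)) (by fun_prop) (fun s => h _),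
    logChange_eq (L := fun t => L (0, t)) (by fun_prop) (fun s => h _),
    logChange_eq (L := fun s => L (s, 1)) (by fun_prop) (fun s => h _)]
  ring

/-- For paths joining finitely many points of the plane there are integers `N k i j`, one for each
vertex `k` and path `i j`, such that every pair of disjoint paths gives a linear relation. -/
theorem exists_int_of_disjoint_paths {n : ℕ} (p : Fin n → ℂ) (γ : ∀ i j, Path (p i) (p j)) :
    ∃ N : Fin n → Fin n → Fin n → ℤ, ∀ i j k l,
      Disjoint (Set.range (γ i j)) (Set.range (γ k l)) →
      2 * (N k i j - N l i j + N j k l - N i k l) + ((if k < j then -1 else 1) +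
        (if i < k then -1 else 1) + (if j < l then -1 else 1) + (if l < i then -1 else 1)) = 0 := by
  -- A fixed logarithm of `p j - p i`, chosen so that reversing the pair changes it by exactly ±πi.
  -- The order of the indices then determines the sign terms of the relation.
  let e : Fin n → Fin n → ℂ := fun i j =>
    if i < j then log (p j - p i) else log (p i - p j) + Real.pi * I
  have he : ∀ i j, p i ≠ p j → exp (e i j) = p j - p i := fun i j hij => by
    dsimp only [e]
    split_ifs
    · rw [exp_log (sub_ne_zero.2 hij.symm)]
    · rw [exp_add, exp_log (sub_ne_zero.2 hij), exp_pi_mul_I]; ring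
  have hes : ∀ i j, p i ≠ p j →
      e i j - e j i = (if i < j then (-1 : ℂ) else 1) * (Real.pi * I) := fun i j hij => by
    rcases lt_trichotomy i j with h | h | h
    · simp only [e, if_pos h, if_neg h.asymm]; ring
    · exact absurd (congrArg p h) hij
    · simp only [e, if_pos h, if_neg h.asymm]; ring
  have hext : ∀ i j t, (γ i j).extend t ∈ Set.range (γ i j) := fun i j t =>
    (γ i j).extend_range ▸ Set.mem_range_self t
  have hN : ∀ k i j, ∃ N : ℤ, p k ∉ Set.range (γ i j) →
      logChange (fun t => (γ i j).extend t - p k) =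
        e k j - e k i + N * (2 * Real.pi * I) := fun k i j => by
    by_cases hk : p k ∈ Set.range (γ i j)
    -- No winding is defined when the path passes through `p k`; the value 0 is never used.
    · exact ⟨0, fun h => absurd hk h⟩
    have h0 : ∀ t, (γ i j).extend t - p k ≠ 0 := fun t ht => hk <| by
      rw [← sub_eq_zero.1 ht]; exact hext i j t
    have hki : p k ≠ p i := fun h => hk ⟨0, by simp [h]⟩
    have hkj : p k ≠ p j := fun h => hk ⟨1, by simp [h]⟩
    have : exp (logChange (fun t => (γ i j).extend t - p k)) = exp (e k j - e k i) := by
      rw [exp_logChange (by fun_prop) h0, exp_sub, he k j hkj, he k i hki]; simp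
    obtain ⟨N, hN⟩ := exp_eq_exp_iff_exists_int.1 this
    exact ⟨N, fun _ => hN⟩
  choose N hN using hN
  refine ⟨N, fun i j k l hd => ?_⟩
  have hki : p k ∉ Set.range (γ i j) := fun h => Set.disjoint_left.1 hd h ⟨0, by simp⟩
  have hli : p l ∉ Set.range (γ i j) := fun h => Set.disjoint_left.1 hd h ⟨1, by simp⟩
  have hik : p i ∉ Set.range (γ k l) := fun h => Set.disjoint_right.1 hd h ⟨0, by simp⟩
  have hjk : p j ∉ Set.range (γ k l) := fun h => Set.disjoint_right.1 hd h ⟨1, by simp⟩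
  have hne : ∀ s t, (γ i j).extend s - (γ k l).extend t ≠ 0 := fun s t h =>
    Set.disjoint_left.1 hd (hext i j s) (sub_eq_zero.1 h ▸ hext k l t)
  -- Disjointness keeps the difference of the paths away from 0. On each side of the square one path
  -- is frozen at an endpoint.
  have hsq := logChange_square (F := fun z => (γ i j).extend z.1 - (γ k l).extend z.2)
    (by fun_prop) (fun z => hne _ _)
  have hflip : ∀ s, logChange (fun t => (γ i j).extend s - (γ k l).extend t) =
      logChange (fun t => (γ k l).extend t - (γ i j).extend s) := fun s => by
    rw [← logChange_neg (by fun_prop) (hne s)]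
    simp
  dsimp only at hsq
  rw [hflip, hflip] at hsq
  simp only [Path.extend_zero, Path.extend_one] at hsq
  rw [hN k i j hki, hN j k l hjk, hN i k l hik, hN l i j hli] at hsq
  have h1 := hes k j (fun h => hjk ⟨0, by simp [h]⟩)
  have h2 := hes i k (fun h => hki ⟨0, by simp [h]⟩)
  have h3 := hes j l (fun h => hli ⟨1, by simp [h]⟩)
  have h4 := hes l i (fun h => hik ⟨1, by simp [h]⟩)
  have hpi : ((Real.pi : ℂ) * I) ≠ 0 := by simp [Real.pi_ne_zero]
  rw [← Int.cast_inj (α := ℂ)]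
  push_cast
  apply mul_right_cancel₀ hpi
  linear_combination hsq - h1 - h2 - h3 - h4

/-- `K₃₃` cannot be drawn in the plane with disjoint edges having disjoint images. -/
theorem not_exists_drawing_K33 (x y : Fin 3 → ℂ) (γ : ∀ i j, Path (x i) (y j))
    (h : ∀ i j k l, i ≠ k → j ≠ l → Disjoint (Set.range (γ i j)) (Set.range (γ k l))) : False := by
  let p : Fin 6 → ℂ := Fin.append x y
  have hx : ∀ i : Fin 3, p (Fin.castAdd 3 i) = x i := fun i => Fin.append_left x y i
  have hy : ∀ i : Fin 3, p (Fin.natAdd 3 i) = y i := fun i => Fin.append_right x y i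
  have hP : ∀ a b : Fin 6, ∃ P : Path (p a) (p b), ∀ i j : Fin 3, a = Fin.castAdd 3 i →
      b = Fin.natAdd 3 j → Set.range P = Set.range (γ i j) := fun a b => by
    by_cases hab : ∃ i j : Fin 3, a = Fin.castAdd 3 i ∧ b = Fin.natAdd 3 j
    · obtain ⟨i, j, rfl, rfl⟩ := hab
      refine ⟨(γ i j).cast (hx i) (hy j), fun i' j' hi hj => ?_⟩
      obtain rfl : i = i' := Fin.castAdd_injective _ _ hi
      obtain rfl : j = j' := Fin.natAdd_injective _ _ hj
      rfl
    -- Pairs that are not edges of K₃₃ get an arbitrary path; their relations are not used.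
    · exact ⟨PathConnectedSpace.somePath _ _, fun i j hi hj => absurd ⟨i, j, hi, hj⟩ hab⟩
  choose P hP using hP
  obtain ⟨N, hN⟩ := exists_int_of_disjoint_paths p P
  have key : ∀ i j k l : Fin 3, i ≠ k → j ≠ l → _ := fun i j k l hik hjl =>
    hN (Fin.castAdd 3 i) (Fin.natAdd 3 j) (Fin.castAdd 3 k) (Fin.natAdd 3 l)
      (by rw [hP _ _ _ _ rfl rfl, hP _ _ _ _ rfl rfl]; exact h i j k l hik hjl)
  clear hN hP
  have key' : ∀ i k j l : Fin 3, i < k → j < l → _ ∧ _ := fun i k j l hik hjl =>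
    And.intro (key i j k l hik.ne hjl.ne) (key i l k j hik.ne hjl.ne')
  have a1 := key' 0 1 0 1 (by decide) (by decide)
  have a2 := key' 0 1 0 2 (by decide) (by decide)
  have a3 := key' 0 1 1 2 (by decide) (by decide)
  have a4 := key' 0 2 0 1 (by decide) (by decide)
  have a5 := key' 0 2 0 2 (by decide) (by decide)
  have a6 := key' 0 2 1 2 (by decide) (by decide)
  have a7 := key' 1 2 0 1 (by decide) (by decide)
  have a8 := key' 1 2 0 2 (by decide) (by decide)
  have a9 := key' 1 2 1 2 (by decide) (by decide)
  clear key key'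
  simp [Fin.lt_def] at a1 a2 a3 a4 a5 a6 a7 a8 a9
  -- The contradiction is parity. After halving, each integer `N k i j` occurs in exactly two of the
  -- 18 relations, while the sign terms contribute -1 for each of the 9 pairs with i < k and j < l,
  -- and 0 otherwise.
  omega

/-- `K₅` cannot be drawn in the plane with disjoint edges having disjoint images. -/
theorem not_exists_drawing_K5 (p : Fin 5 → ℂ) (γ : ∀ i j, Path (p i) (p j))
    (h : ∀ i j k l, i < j → k < l → i ≠ k → i ≠ l → j ≠ k → j ≠ l →
      Disjoint (Set.range (γ i j)) (Set.range (γ k l))) : False := by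
  obtain ⟨N, hN⟩ := exists_int_of_disjoint_paths p γ
  have key : ∀ i j k l : Fin 5, i < j → j < k → k < l → _ ∧ _ ∧ _ := fun i j k l hij hjk hkl =>
    And.intro (hN i j k l (h i j k l hij hkl (hij.trans hjk).ne (hij.trans (hjk.trans hkl)).ne
      hjk.ne (hjk.trans hkl).ne)) <| And.intro
    (hN i k j l (h i k j l (hij.trans hjk) (hjk.trans hkl) hij.ne (hij.trans (hjk.trans hkl)).ne
      hjk.ne' hkl.ne))
    (hN i l j k (h i l j k (hij.trans (hjk.trans hkl)) hjk hij.ne (hij.trans hjk).ne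
      (hjk.trans hkl).ne' hkl.ne'))
  have a1 := key 0 1 2 3 (by decide) (by decide) (by decide)
  have a2 := key 0 1 2 4 (by decide) (by decide) (by decide)
  have a3 := key 0 1 3 4 (by decide) (by decide) (by decide)
  have a4 := key 0 2 3 4 (by decide) (by decide) (by decide)
  have a5 := key 1 2 3 4 (by decide) (by decide) (by decide)
  clear hN key
  simp [Fin.lt_def] at a1 a2 a3 a4 a5
  -- Parity again: each integer occurs in two of the 15 halved relations, and each of the five
  -- quadruples i < j < k < l contributes one odd sign term, from the pair ik, jl.
  omega

/-- No six points of `ℝ × ℝ` are joined as in `K₃₃` inside sets that are disjoint for disjoint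
edges. -/
theorem not_exists_joinedIn_K33 (x y : Fin 3 → ℝ × ℝ) (A : Fin 3 → Fin 3 → Set (ℝ × ℝ))
    (hA : ∀ i j, JoinedIn (A i j) (x i) (y j))
    (h : ∀ i j k l, i ≠ k → j ≠ l → Disjoint (A i j) (A k l)) : False := by
  let e := equivRealProdCLM.symm
  refine not_exists_drawing_K33 (fun i => e (x i)) (fun j => e (y j))
    (fun i j => (hA i j).somePath.map e.continuous) fun i j k l hik hjl => ?_
  rw [Set.disjoint_left]
  rintro _ ⟨s, rfl⟩ ⟨t, ht⟩
  have ht' : (hA k l).somePath t = (hA i j).somePath s := e.injective ht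
  exact Set.disjoint_left.1 (h i j k l hik hjl) ((hA i j).somePath_mem s)
    (ht' ▸ (hA k l).somePath_mem t)

/-- No five points of `ℝ × ℝ` are joined as in `K₅` inside sets that are disjoint for disjoint
edges. -/
theorem not_exists_joinedIn_K5 (p : Fin 5 → ℝ × ℝ) (A : Fin 5 → Fin 5 → Set (ℝ × ℝ))
    (hA : ∀ i j, i < j → JoinedIn (A i j) (p i) (p j))
    (h : ∀ i j k l, i < j → k < l → i ≠ k → i ≠ l → j ≠ k → j ≠ l →
      Disjoint (A i j) (A k l)) : False := by
  let e := equivRealProdCLM.symm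
  have hP : ∀ i j, ∃ P : Path (p i) (p j), i < j → ∀ t, P t ∈ A i j := fun i j => by
    by_cases hij : i < j
    · exact ⟨(hA i j hij).somePath, fun _ => (hA i j hij).somePath_mem⟩
    · exact ⟨PathConnectedSpace.somePath _ _, fun h => absurd h hij⟩
  choose P hP using hP
  refine not_exists_drawing_K5 (fun i => e (p i)) (fun i j => (P i j).map e.continuous)
    fun i j k l hij hkl h1 h2 h3 h4 => ?_
  rw [Set.disjoint_left]
  rintro _ ⟨s, rfl⟩ ⟨t, ht⟩
  have ht' : P k l t = P i j s := e.injective ht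
  exact Set.disjoint_left.1 (h i j k l hij hkl h1 h2 h3 h4) (hP i j hij s)
    (ht' ▸ hP k l hkl t)

end Complex

/-! ### Cone drawings and the minors they exclude. -/

namespace SimpleGraph

variable {V : Type*} {G : SimpleGraph V}

/-- `u` and `v` are joined by a walk of `G` inside `A`. -/
def Linked (G : SimpleGraph V) (A : Set V) : V → V → Prop :=
  Relation.ReflTransGen fun u v => G.Adj u v ∧ u ∈ A ∧ v ∈ A

namespace Linked

theorem mono {A B : Set V} (hAB : A ⊆ B) {u v : V} (h : G.Linked A u v) : G.Linked B u v :=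
  Relation.ReflTransGen.mono (fun _ _ h => ⟨h.1, hAB h.2.1, hAB h.2.2⟩) _ _ h

theorem symm {A : Set V} {u v : V} (h : G.Linked A u v) : G.Linked A v u := by
  induction h with
  | refl => exact .refl
  | tail _ h ih => exact .head ⟨h.1.symm, h.2.2, h.2.1⟩ ih

theorem trans {A : Set V} {u v w : V} (h : G.Linked A u v) (h' : G.Linked A v w) :
    G.Linked A u w :=
  Relation.ReflTransGen.trans h h'

theorem of_adj {A : Set V} {u v : V} (h : G.Adj u v) (hu : u ∈ A) (hv : v ∈ A) : G.Linked A u v :=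
  Relation.ReflTransGen.single ⟨h, hu, hv⟩

theorem mem {A : Set V} {u v : V} (h : G.Linked A u v) (hu : u ∈ A) : v ∈ A := by
  induction h with
  | refl => exact hu
  | tail _ h _ => exact h.2.2

theorem component {A : Set V} {u v : V} (h : G.Linked A u v) :
    G.Linked {w | G.Linked A u w} u v := by
  induction h with
  | refl => exact .refl
  | tail h₁ h₂ ih => exact ih.tail ⟨h₂.1, h₁, h₁.tail h₂⟩

theorem of_seq {A : Set V} {f : ℕ → V} {i j : ℕ} (hij : i ≤ j)
    (hA : ∀ t, i ≤ t → t ≤ j → f t ∈ A) (hf : ∀ t, i ≤ t → t < j → G.Adj (f t) (f (t + 1))) :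
    G.Linked A (f i) (f j) := by
  induction j, hij using Nat.le_induction with
  | base => exact .refl
  | succ j hij ih =>
    exact (ih (fun t h₁ h₂ => hA t h₁ (by omega)) (fun t h₁ h₂ => hf t h₁ (by omega))).tail
      ⟨hf j hij (by omega), hA j hij (by omega), hA _ (by omega) le_rfl⟩

theorem exists_seq {A : Set V} {u v : V} (h : G.Linked A u v) (hu : u ∈ A) :
    ∃ (k : ℕ) (f : ℕ → V), f 0 = u ∧ f k = v ∧ (∀ i ≤ k, f i ∈ A) ∧
      ∀ i < k, G.Adj (f i) (f (i + 1)) := by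
  induction h with
  | refl => exact ⟨0, fun _ => u, rfl, rfl, fun _ _ => hu, fun _ h => absurd h (by omega)⟩
  | @tail b c _ hbc ih =>
    obtain ⟨k, f, h0, hk, hA, hf⟩ := ih
    refine ⟨k + 1, fun i => if i ≤ k then f i else c, by simpa using h0, by simp, ?_, ?_⟩
    · intro i _
      dsimp only
      split_ifs with h
      · exact hA i h
      · exact hbc.2.2
    · intro i hi
      dsimp only
      rw [if_pos (by omega)]
      split_ifs with h
      · exact hf i (by omega)
      · obtain rfl : i = k := by omega
        rw [hk]; exact hbc.1

end Linked

/-- A planar drawing of the graph obtained from `G[S]` by adding an apex joined to every vertex,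
where only disjoint edges are required to be drawn disjointly. -/
structure ConeDrawing (G : SimpleGraph V) (S : Finset V) where
  point : V → ℝ × ℝ
  arc : Sym2 V → Set (ℝ × ℝ)
  apex : ℝ × ℝ
  ray : V → Set (ℝ × ℝ)
  joinedIn_arc : ∀ u ∈ S, ∀ v ∈ S, G.Adj u v → JoinedIn (arc s(u, v)) (point u) (point v)
  joinedIn_ray : ∀ v ∈ S, JoinedIn (ray v) apex (point v)
  point_ne : ∀ u ∈ S, ∀ v ∈ S, u ≠ v → point u ≠ point v
  point_notMem_arc : ∀ w ∈ S, ∀ u ∈ S, ∀ v ∈ S, G.Adj u v → w ≠ u → w ≠ v →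
    point w ∉ arc s(u, v)
  disjoint_arc : ∀ a ∈ S, ∀ b ∈ S, ∀ c ∈ S, ∀ d ∈ S, G.Adj a b → G.Adj c d →
    a ≠ c → a ≠ d → b ≠ c → b ≠ d → Disjoint (arc s(a, b)) (arc s(c, d))
  point_notMem_ray : ∀ w ∈ S, ∀ v ∈ S, w ≠ v → point w ∉ ray v
  disjoint_ray : ∀ w ∈ S, ∀ u ∈ S, ∀ v ∈ S, G.Adj u v → w ≠ u → w ≠ v →
    Disjoint (ray w) (arc s(u, v))

namespace ConeDrawing

variable {S : Finset V}

/-- The part of the plane covered by the drawing of `G[A]`. -/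
def region (D : G.ConeDrawing S) (A : Set V) : Set (ℝ × ℝ) :=
  {z | (∃ u ∈ A, z = D.point u) ∨ ∃ u ∈ A, ∃ v ∈ A, G.Adj u v ∧ z ∈ D.arc s(u, v)}

theorem joinedIn_region (D : G.ConeDrawing S) {A : Set V} (hA : A ⊆ S) {u v : V} (hu : u ∈ A)
    (h : G.Linked A u v) :
    JoinedIn (D.region A) (D.point u) (D.point v) := by
  induction h with
  | refl => exact JoinedIn.refl (Or.inl ⟨u, hu, rfl⟩)
  | @tail b c _ h ih =>
    exact ih.trans ((D.joinedIn_arc b (hA h.2.1) c (hA h.2.2) h.1).mono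
      fun z hz => Or.inr ⟨b, h.2.1, c, h.2.2, h.1, hz⟩)

theorem disjoint_region (D : G.ConeDrawing S) {A B : Set V} (hA : A ⊆ S) (hB : B ⊆ S)
    (hAB : Disjoint A B) :
    Disjoint (D.region A) (D.region B) := by
  have hne : ∀ a ∈ A, ∀ b ∈ B, a ≠ b := fun a ha b hb h => Set.disjoint_left.1 hAB ha (h ▸ hb)
  rw [Set.disjoint_left]
  rintro z (⟨u, hu, rfl⟩ | ⟨u, hu, v, hv, huv, hz⟩) (⟨x, hx, hz'⟩ | ⟨x, hx, y, hy, hxy, hz'⟩)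
  · exact D.point_ne u (hA hu) x (hB hx) (hne u hu x hx) hz'
  · exact D.point_notMem_arc u (hA hu) x (hB hx) y (hB hy) hxy (hne u hu x hx) (hne u hu y hy) hz'
  · exact D.point_notMem_arc x (hB hx) u (hA hu) v (hA hv) huv (hne u hu x hx).symm
      (hne v hv x hx).symm (hz' ▸ hz)
  · exact Set.disjoint_left.1 (D.disjoint_arc u (hA hu) v (hA hv) x (hB hx) y (hB hy) huv hxy
      (hne u hu x hx) (hne u hu y hy) (hne v hv x hx) (hne v hv y hy)) hz hz'

theorem disjoint_ray_region (D : G.ConeDrawing S) {A : Set V} (hA : A ⊆ S) {w : V} (hw : w ∈ S)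
    (hwA : w ∉ A) :
    Disjoint (D.ray w) (D.region A) := by
  have hne : ∀ a ∈ A, w ≠ a := fun a ha h => hwA (h ▸ ha)
  rw [Set.disjoint_left]
  rintro z hz (⟨x, hx, rfl⟩ | ⟨x, hx, y, hy, hxy, hz'⟩)
  · exact D.point_notMem_ray x (hA hx) w hw (hne x hx).symm hz
  · exact Set.disjoint_left.1 (D.disjoint_ray w hw x (hA hx) y (hA hy) hxy (hne x hx) (hne y hy))
      hz hz'

/-- A graph with a cone drawing has no `K₂₃` minor. -/
theorem no_K23 (D : G.ConeDrawing S) {x y : V} (hx : x ∈ S) (hy : y ∈ S) (hxy : x ≠ y)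
    (A : Fin 3 → Set V) (q : Fin 3 → V)
    (hA : ∀ i, A i ⊆ S) (hq : ∀ i, q i ∈ A i) (hd : ∀ i j, i ≠ j → Disjoint (A i) (A j))
    (hxA : ∀ i, x ∉ A i) (hyA : ∀ i, y ∉ A i)
    (hlx : ∀ i, G.Linked (insert x (A i)) (q i) x)
    (hly : ∀ i, G.Linked (insert y (A i)) (q i) y) : False := by
  have hix : ∀ i, insert x (A i) ⊆ (S : Set V) := fun i => Set.insert_subset hx (hA i)
  have hiy : ∀ i, insert y (A i) ⊆ (S : Set V) := fun i => Set.insert_subset hy (hA i)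
  have hqA : ∀ i j, i ≠ j → q i ∉ A j := fun i j hij h => Set.disjoint_left.1 (hd i j hij) (hq i) h
  have hqx : ∀ i j, i ≠ j → q i ∉ insert x (A j) := fun i j hij h =>
    h.elim (fun h => hxA i (h ▸ hq i)) (hqA i j hij)
  have hqy : ∀ i j, i ≠ j → q i ∉ insert y (A j) := fun i j hij h =>
    h.elim (fun h => hyA i (h ▸ hq i)) (hqA i j hij)
  have hxy' : ∀ i j, i ≠ j → Disjoint (insert x (A i)) (insert y (A j)) := fun i j hij => by
    rw [Set.disjoint_left]
    rintro z (rfl | hz) (hz' | hz')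
    · exact hxy hz'
    · exact hxA _ hz'
    · exact hyA _ (hz' ▸ hz)
    · exact Set.disjoint_left.1 (hd i j hij) hz hz'
  have h01 := fun i j hij => D.disjoint_region (hix i) (hiy j) (hxy' i j hij)
  have h20 := fun i j (hij : i ≠ j) => D.disjoint_ray_region (hix j) (hA i (hq i)) (hqx i j hij)
  have h21 := fun i j (hij : i ≠ j) => D.disjoint_ray_region (hiy j) (hA i (hq i)) (hqy i j hij)
  -- One side of K₃₃ consists of x, y and the apex, the other of one vertex from each branch set.
  refine Complex.not_exists_joinedIn_K33 ![D.point x, D.point y, D.apex] (fun j => D.point (q j))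
    ![fun j => D.region (insert x (A j)), fun j => D.region (insert y (A j)), fun j => D.ray (q j)]
    ?_ ?_
  · intro i j
    fin_cases i
    · exact (D.joinedIn_region (hix j) (Or.inr (hq j)) (hlx j)).symm
    · exact (D.joinedIn_region (hiy j) (Or.inr (hq j)) (hly j)).symm
    · exact D.joinedIn_ray _ (hA j (hq j))
  · intro i j k l hik hjl
    fin_cases i <;> fin_cases k <;> first | exact absurd rfl hik | skip
    · exact h01 j l hjl
    · exact (h20 l j hjl.symm).symm
    · exact (h01 l j hjl.symm).symm
    · exact (h21 l j hjl.symm).symm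
    · exact h20 j l hjl
    · exact h21 j l hjl

/-- A graph with a cone drawing has no `K₄` minor. -/
theorem no_K4 (D : G.ConeDrawing S) (B : Fin 4 → Set V) (q : Fin 4 → V)
    (hB : ∀ i, B i ⊆ S) (hq : ∀ i, q i ∈ B i)
    (hd : ∀ i j, i ≠ j → Disjoint (B i) (B j))
    (hl : ∀ i j, i < j → G.Linked (B i ∪ B j) (q i) (q j)) : False := by
  have hBB : ∀ i j, B i ∪ B j ⊆ (S : Set V) := fun i j => Set.union_subset (hB i) (hB j)
  have hray : ∀ i k l, i ≠ k → i ≠ l → Disjoint (D.ray (q i)) (D.region (B k ∪ B l)) :=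
    fun i k l hik hil => D.disjoint_ray_region (hBB k l) (hB i (hq i)) fun h => h.elim
      (Set.disjoint_left.1 (hd i k hik) (hq i)) (Set.disjoint_left.1 (hd i l hil) (hq i))
  -- The last index is the apex. The value ∅ belongs to pairs starting at the last index, which are
  -- never increasing.
  refine Complex.not_exists_joinedIn_K5 (Fin.lastCases D.apex fun i => D.point (q i))
    (fun i j => Fin.lastCases ∅ (fun i => Fin.lastCases (D.ray (q i))
      (fun j => D.region (B i ∪ B j)) j) i) ?_ ?_
  · intro i j hij
    cases i using Fin.lastCases with
    | last => exact absurd hij (Fin.le_last j).not_gt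
    | cast i =>
      cases j using Fin.lastCases with
      | last =>
        simpa only [Fin.lastCases_last, Fin.lastCases_castSucc] using
          (D.joinedIn_ray _ (hB i (hq i))).symm
      | cast j =>
        simpa using D.joinedIn_region (hBB i j) (Or.inl (hq i)) (hl i j (by simpa using hij))
  · intro i j k l hij hkl h1 h2 h3 h4
    cases i using Fin.lastCases with
    | last => exact absurd hij (Fin.le_last j).not_gt
    | cast i =>
    cases k using Fin.lastCases with
    | last => exact absurd hkl (Fin.le_last l).not_gt
    | cast k =>
    have h1' : i ≠ k := fun h => h1 (h ▸ rfl)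
    cases j using Fin.lastCases with
    | last =>
      cases l using Fin.lastCases with
      | last => exact absurd rfl h4
      | cast l =>
        simpa only [Fin.lastCases_last, Fin.lastCases_castSucc] using
          hray i k l h1' fun h => h2 (h ▸ rfl)
    | cast j =>
      cases l using Fin.lastCases with
      | last =>
        simpa only [Fin.lastCases_last, Fin.lastCases_castSucc] using
          (hray k i j h1'.symm fun h => h3 (h ▸ rfl)).symm
      | cast l =>
        have h2' : i ≠ l := fun h => h2 (h ▸ rfl)
        have h3' : j ≠ k := fun h => h3 (h ▸ rfl)
        have h4' : j ≠ l := fun h => h4 (h ▸ rfl)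
        simpa using D.disjoint_region (hBB i j) (hBB k l) (by
          simp only [Set.disjoint_union_left, Set.disjoint_union_right]
          exact ⟨⟨hd i k h1', hd j k h3'⟩, hd i l h2', hd j l h4'⟩)

end ConeDrawing

end SimpleGraph

/-! ### Reducible configurations at minimum degree two. -/

namespace SimpleGraph

variable {V : Type*} {G : SimpleGraph V}

/-- Two vertices joined by a walk through `T` are joined by an induced path through `T`. -/
theorem exists_induced_path {T : Set V} {a b s t : V} (hab : a ≠ b) (ha : a ∉ T) (hb : b ∉ T)
    (has : G.Adj a s) (hbt : G.Adj b t) (hs : s ∈ T) (hst : G.Linked T s t) :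
    ∃ (m : ℕ) (f : ℕ → V), 1 ≤ m ∧ f 0 = a ∧ f (m + 1) = b ∧ (∀ i, 1 ≤ i → i ≤ m → f i ∈ T) ∧
      (∀ i ≤ m, G.Adj (f i) (f (i + 1))) ∧
      (∀ i j, i < j → j ≤ m + 1 → f i ≠ f j) ∧
      ∀ i j, i < j → j ≤ m + 1 → G.Adj (f i) (f j) → j = i + 1 ∨ (i = 0 ∧ j = m + 1) := by
  classical
  have hex : ∃ (m : ℕ), ∃ f : ℕ → V, 1 ≤ m ∧ f 0 = a ∧ f (m + 1) = b ∧
      (∀ i, 1 ≤ i → i ≤ m → f i ∈ T) ∧ ∀ i ≤ m, G.Adj (f i) (f (i + 1)) := by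
    obtain ⟨k, g, h0, hk, hT, hg⟩ := hst.exists_seq hs
    refine ⟨k + 1, fun i => if i = 0 then a else if i ≤ k + 1 then g (i - 1) else b,
      by omega, by simp, by simp, ?_, ?_⟩
    · intro i h1 h2
      dsimp only
      rw [if_neg (by omega), if_pos h2]
      exact hT _ (by omega)
    · intro i hi
      dsimp only
      rcases Nat.eq_zero_or_pos i with rfl | hpos
      · simpa [h0] using has
      · rw [if_neg (by omega), if_pos hi, if_neg (by omega)]
        split_ifs with h
        · have := hg (i - 1) (by omega)
          rwa [Nat.sub_add_cancel hpos] at this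
        · obtain rfl : i = k + 1 := by omega
          simpa [hk] using hbt.symm
  obtain ⟨f, hm, h0, h1, hT, hf⟩ := Nat.find_spec hex
  have hmin := fun k => Nat.find_min hex (m := k)
  set m := Nat.find hex
  -- A chord skipping d interior vertices would give a shorter path. The bound d < m keeps an
  -- interior vertex, so an edge from a to b is not excluded.
  have hshort : ∀ i d, 1 ≤ d → d < m → i + d ≤ m → ¬ G.Adj (f i) (f (i + d + 1)) := by
    intro i d hd hdm hid hadj
    refine hmin (m - d) (by omega)
      ⟨fun t => if t ≤ i then f t else f (t + d), by omega, by simpa using h0, ?_, ?_, ?_⟩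
    · dsimp only
      rw [if_neg (by omega), ← h1]
      congr 1; omega
    · intro t h1 h2
      dsimp only
      split_ifs
      · exact hT t h1 (by omega)
      · exact hT _ (by omega) (by omega)
    · intro t ht
      dsimp only
      split_ifs with h h' h'
      · exact hf t (by omega)
      · obtain rfl : t = i := by omega
        rwa [add_right_comm] at hadj
      · omega
      · have := hf (t + d) (by omega)
        rwa [add_right_comm] at this
  have hend : ∀ i, 1 ≤ i → i ≤ m → f i ≠ a ∧ f i ≠ b := fun i h1 h2 =>
    ⟨fun h => ha (h ▸ hT i h1 h2), fun h => hb (h ▸ hT i h1 h2)⟩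
  refine ⟨m, f, hm, h0, h1, hT, hf, ?_, ?_⟩
  · intro i j hij hj heq
    rcases Nat.eq_zero_or_pos i with rfl | hi
    · rcases Nat.lt_or_ge j (m + 1) with h | h
      · exact (hend j (by omega) (by omega)).1 (heq ▸ h0)
      · obtain rfl : j = m + 1 := by omega
        exact hab (h0.symm.trans (heq.trans h1))
    · rcases Nat.lt_or_ge j (m + 1) with h | h
      -- A repetition f i = f j turns the edge from f (i - 1) to f i into a chord ending at f j.
      · have hadj := hf (i - 1) (by omega)
        rw [Nat.sub_add_cancel hi, heq] at hadj
        refine hshort (i - 1) (j - i) (by omega) (by omega) (by omega) ?_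
        rwa [show i - 1 + (j - i) + 1 = j by omega]
      · obtain rfl : j = m + 1 := by omega
        exact (hend i (by omega) (by omega)).2 (heq.trans h1)
  · intro i j hij hj hadj
    by_contra hcon
    push Not at hcon
    refine hshort i (j - i - 1) (by omega) ?_ (by omega) ?_
    · by_contra hlt
      exact hcon.2 (by omega) (by omega)
    · rwa [show i + (j - i - 1) + 1 = j by omega]

/-- The component of `s` in `A`, together with a neighbour `c` of it. -/
theorem Linked.insert_component {A : Set V} {s v c : V} (h : G.Linked A s v) (hvc : G.Adj v c) :
    G.Linked (insert c {w | G.Linked A s w}) s c :=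
  (h.component.mono (Set.subset_insert _ _)).tail ⟨hvc, Or.inr h, Or.inl rfl⟩

open Classical in
/-- A set `T` of vertices attached to the rest of `S` along a clique of size at most two contains,
if all degrees are at least two, a vertex of degree two in a triangle or two adjacent vertices of
degree two. -/
theorem ConeDrawing.exists_reducible_of_root {S : Finset V} (D : G.ConeDrawing S)
    (hdeg : ∀ v ∈ S, 2 ≤ (S.filter (G.Adj v)).card) (T R : Finset V) (hTS : T ⊆ S) (hRS : R ⊆ S)
    (hTR : Disjoint T R) (hT : T.Nonempty)
    (hN : ∀ v ∈ T, ∀ u ∈ S, G.Adj v u → u ∈ T ∨ u ∈ R)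
    (hR : ∀ u ∈ R, ∀ v ∈ R, u ≠ v → G.Adj u v) (hR2 : R.card ≤ 2) :
    ∃ u ∈ S, ∃ x ∈ S, ∃ v ∈ S, x ≠ v ∧ S.filter (G.Adj u) = {x, v} ∧
      (G.Adj x v ∨ ∃ y ∈ S, y ≠ u ∧ S.filter (G.Adj v) = {u, y}) := by
  induction hn : T.card using Nat.strong_induction_on generalizing T R with
  | _ n ih =>
  have hother : ∀ v ∈ S, ∀ a, ∃ u ∈ S, G.Adj v u ∧ u ≠ a := fun v hv a => by
    obtain ⟨u, hu, hua⟩ := Finset.exists_mem_ne (Nat.lt_of_lt_of_le one_lt_two (hdeg v hv)) a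
    exact ⟨u, (Finset.mem_filter.1 hu).1, (Finset.mem_filter.1 hu).2, hua⟩
  -- A disconnected T is replaced by one of its components, which is attached along the same clique.
  by_cases hconn : ∃ s ∈ T, ∃ t ∈ T, ¬ G.Linked T s t
  · obtain ⟨s, hs, t, ht, hst⟩ := hconn
    have hsub : T.filter (G.Linked T s) ⊂ T :=
      Finset.filter_ssubset.2 ⟨t, ht, hst⟩
    refine ih _ (hn ▸ Finset.card_lt_card hsub) (T.filter (G.Linked T s)) R (hsub.1.trans hTS) hRS
      (Finset.disjoint_of_subset_left hsub.1 hTR) ⟨s, Finset.mem_filter.2 ⟨hs, .refl⟩⟩ ?_ hR hR2 rfl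
    intro v hv u hu hvu
    rw [Finset.mem_filter] at hv
    refine (hN v hv.1 u hu hvu).imp_left fun huT => ?_
    exact Finset.mem_filter.2 ⟨huT, hv.2.tail ⟨hvu, hv.1, huT⟩⟩
  push Not at hconn
  set Q := R.filter fun r => ∃ s ∈ T, G.Adj r s with hQ
  have hQR : Q ⊆ R := Finset.filter_subset _ _
  have hNQ : ∀ v ∈ T, ∀ u ∈ S, G.Adj v u → u ∈ T ∨ u ∈ Q := fun v hv u hu hvu =>
    (hN v hv u hu hvu).imp_right fun h => Finset.mem_filter.2 ⟨h, v, hv, hvu.symm⟩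
  have hQadj : ∀ r ∈ Q, ∃ s ∈ T, G.Adj r s := fun r hr => (Finset.mem_filter.1 hr).2
  have hTne : ∀ r ∈ R, r ∉ T := fun r hr h => Finset.disjoint_left.1 hTR h hr
  -- Removing a vertex `s` of `T` and adding it to the root.
  have hmove : ∀ s ∈ T, (Q = ∅ ∨ ∃ a, Q = {a} ∧ G.Adj a s) →
      ∃ u ∈ S, ∃ x ∈ S, ∃ v ∈ S, x ≠ v ∧ S.filter (G.Adj u) = {x, v} ∧
      (G.Adj x v ∨ ∃ y ∈ S, y ≠ u ∧ S.filter (G.Adj v) = {u, y}) := by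
    intro s hs hcase
    refine ih _ (hn ▸ Finset.card_erase_lt_of_mem hs) (T.erase s) (insert s Q)
      ((Finset.erase_subset _ _).trans hTS)
      (Finset.insert_subset (hTS hs) (hQR.trans hRS)) ?_ ?_ ?_ ?_ ?_ rfl
    · rw [Finset.disjoint_left]
      intro x hx hx'
      rcases Finset.mem_insert.1 hx' with rfl | hx'
      · exact Finset.notMem_erase _ _ hx
      · exact hTne x (hQR hx') (Finset.mem_of_mem_erase hx)
    -- Degree at least two gives s a neighbour outside Q, so something of T remains.
    · rcases hcase with h | ⟨a, h, -⟩
      · obtain ⟨u, hu, hsu, -⟩ := hother s (hTS hs) s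
        refine ⟨u, Finset.mem_erase.2 ⟨hsu.ne', ?_⟩⟩
        simpa [h] using hNQ s hs u hu hsu
      · obtain ⟨u, hu, hsu, hua⟩ := hother s (hTS hs) a
        refine ⟨u, Finset.mem_erase.2 ⟨hsu.ne', ?_⟩⟩
        simpa [h, hua] using hNQ s hs u hu hsu
    · intro v hv u hu hvu
      rcases hNQ v (Finset.mem_of_mem_erase hv) u hu hvu with h | h
      · by_cases hus : u = s
        · exact Or.inr (Finset.mem_insert.2 (Or.inl hus))
        · exact Or.inl (Finset.mem_erase.2 ⟨hus, h⟩)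
      · exact Or.inr (Finset.mem_insert_of_mem h)
    · rcases hcase with h | ⟨a, h, has⟩
      · intro u hu v hv huv
        rw [h] at hu hv
        simp only [insert_empty_eq, Finset.mem_singleton] at hu hv
        exact absurd (hu.trans hv.symm) huv
      · intro u hu v hv huv
        simp only [h, Finset.mem_insert, Finset.mem_singleton] at hu hv
        rcases hu with rfl | rfl <;> rcases hv with rfl | rfl
        · exact absurd rfl huv
        · exact has.symm
        · exact has
        · exact absurd rfl huv
    · rcases hcase with h | ⟨a, h, -⟩
      · simp [h]
      · rw [h]; exact Finset.card_le_two
  have hQ2 : Q.card ≤ 2 := (Finset.card_le_card hQR).trans hR2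
  rcases Nat.lt_or_ge Q.card 2 with hQlt | hQge
  · rcases Nat.lt_or_ge Q.card 1 with hQ0 | hQ1
    · obtain ⟨s, hs⟩ := hT
      exact hmove s hs (Or.inl (Finset.card_eq_zero.1 (by omega)))
    · obtain ⟨a, ha⟩ := Finset.card_eq_one.1 (by omega : Q.card = 1)
      obtain ⟨s, hs, has⟩ := hQadj a (by simp [ha])
      exact hmove s hs (Or.inr ⟨a, ha, has⟩)
  obtain ⟨a, b, hab, hQab⟩ := Finset.card_eq_two.1 (by omega : Q.card = 2)
  have haQ : a ∈ Q := by simp [hQab]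
  have hbQ : b ∈ Q := by simp [hQab]
  have hadjab : G.Adj a b := hR a (hQR haQ) b (hQR hbQ) hab
  obtain ⟨s, hs, has⟩ := hQadj a haQ
  obtain ⟨t, ht, hbt⟩ := hQadj b hbQ
  -- A shortest path from a to b through T closes up with the edge a b to an induced cycle, with
  -- vertex set P below.
  obtain ⟨m, f, hm, h0, h1, hfT, hf, hinj, hind⟩ := exists_induced_path hab
    (T := (T : Set V)) (by simpa using hTne a (hQR haQ)) (by simpa using hTne b (hQR hbQ)) has hbt
    hs (hconn s hs t ht)
  have hfS : ∀ i ≤ m + 1, f i ∈ S := fun i hi => by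
    rcases Nat.eq_zero_or_pos i with rfl | hpos
    · rw [h0]; exact hRS (hQR haQ)
    · rcases Nat.lt_or_ge i (m + 1) with h | h
      · exact hTS (hfT i hpos (by omega))
      · rw [show i = m + 1 by omega, h1]; exact hRS (hQR hbQ)
  have hinj' : ∀ i j, i ≤ m + 1 → j ≤ m + 1 → f i = f j → i = j := fun i j hi hj h => by
    rcases lt_trichotomy i j with hij | hij | hij
    · exact absurd h (hinj i j hij hj)
    · exact hij
    · exact absurd h.symm (hinj j i hij hi)
  set P : Finset V := (Finset.range (m + 2)).image f with hP
  have hmemP : ∀ z, z ∈ P ↔ ∃ i ≤ m + 1, f i = z := fun z => by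
    simp [hP, Nat.lt_succ_iff]
  have hQP : Q ⊆ P := fun z hz => by
    rw [hQab] at hz
    rcases Finset.mem_insert.1 hz with rfl | hz
    · exact (hmemP _).2 ⟨0, by omega, h0⟩
    · exact (hmemP _).2 ⟨m + 1, le_rfl, h1.trans (Finset.mem_singleton.1 hz).symm⟩
  -- If T lies on the cycle, every interior path vertex has only its two cycle neighbours: m = 1
  -- gives a triangle, m ≥ 2 two adjacent vertices of degree two.
  by_cases hTP : T ⊆ P
  · have hnbr : ∀ i, 1 ≤ i → i ≤ m → S.filter (G.Adj (f i)) = {f (i - 1), f (i + 1)} := by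
      intro i hi1 hi2
      have hpred := hf (i - 1) (by omega)
      rw [Nat.sub_add_cancel hi1] at hpred
      ext z
      simp only [Finset.mem_filter, Finset.mem_insert, Finset.mem_singleton]
      constructor
      · rintro ⟨hzS, hz⟩
        have hzP : z ∈ P := (hNQ (f i) (hfT i hi1 hi2) z hzS hz).elim (fun h => hTP h)
          (fun h => hQP h)
        obtain ⟨j, hj, rfl⟩ := (hmemP z).1 hzP
        rcases lt_trichotomy i j with hij | hij | hij
        · rcases hind i j hij hj hz with h | h
          · exact Or.inr (by rw [h])
          · omega
        · exact absurd (hij ▸ hz) (G.loopless.irrefl _)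
        · rcases hind j i hij (by omega) hz.symm with h | h
          · exact Or.inl (by rw [h, Nat.add_sub_cancel])
          · omega
      · rintro (rfl | rfl)
        · exact ⟨hfS _ (by omega), hpred.symm⟩
        · exact ⟨hfS _ (by omega), hf i hi2⟩
    refine ⟨f 1, hfS 1 (by omega), f 0, hfS 0 (by omega), f 2, hfS 2 (by omega),
      hinj 0 2 (by omega) (by omega), hnbr 1 le_rfl hm, ?_⟩
    rcases Nat.lt_or_ge m 2 with hm2 | hm2
    · left
      obtain rfl : m = 1 := by omega
      rw [h0, h1]; exact hadjab
    · exact Or.inr ⟨f 3, hfS 3 (by omega), (hinj 1 3 (by omega) (by omega)).symm, hnbr 2 (by omega) hm2⟩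
  -- Otherwise a component K of T off the cycle is attached along a set N of cycle vertices. It
  -- remains to see that N is a clique of size at most two, so that the induction applies to K and
  -- N.
  obtain ⟨s, hsT, hsP⟩ := Finset.not_subset.1 hTP
  set A : Set V := (T : Set V) \ P with hA
  set K : Finset V := T.filter (G.Linked A s) with hK
  have hsA : s ∈ A := ⟨hsT, hsP⟩
  have hKmem : ∀ v, v ∈ K ↔ G.Linked A s v := fun v =>
    ⟨fun h => (Finset.mem_filter.1 h).2, fun h => Finset.mem_filter.2 ⟨(h.mem hsA).1, h⟩⟩
  have hKset : (K : Set V) = {w | G.Linked A s w} := Set.ext hKmem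
  have hKP : ∀ v ∈ K, v ∉ P := fun v hv => (((hKmem v).1 hv).mem hsA).2
  have hKS : K ⊆ S := (Finset.filter_subset _ _).trans hTS
  have hPS : P ⊆ S := fun z hz => by
    obtain ⟨i, hi, rfl⟩ := (hmemP z).1 hz
    exact hfS i hi
  have hsK : s ∈ K := (hKmem s).2 .refl
  set N := P.filter fun c => ∃ v ∈ K, G.Adj v c with hNdef
  have hNlink : ∀ c ∈ N, G.Linked (insert c (K : Set V)) s c := fun c hc => by
    obtain ⟨-, v, hv, hvc⟩ := Finset.mem_filter.1 hc
    rw [hKset]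
    exact ((hKmem v).1 hv).insert_component hvc
  have hNP : N ⊆ P := Finset.filter_subset _ _
  have hPK : ∀ c ∈ P, c ∉ (K : Set V) := fun c hc h => hKP c h hc
  -- Nonadjacent attachments f i, f j would be the poles of a K₂₃ minor with branch sets K and the
  -- two open arcs B, C of the cycle, C being the one that may use the edge a b.
  have hNclique : ∀ i j, i < j → j ≤ m + 1 → f i ∈ N → f j ∈ N → G.Adj (f i) (f j) := by
    intro i j hij hj hiN hjN
    by_contra hnadj
    have hij2 : j ≠ i + 1 := fun h => hnadj (h ▸ hf i (by omega))
    have hij0 : ¬ (i = 0 ∧ j = m + 1) := fun h => hnadj (by rw [h.1, h.2, h0, h1]; exact hadjab)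
    have hedge : G.Adj (f 0) (f (m + 1)) := by rw [h0, h1]; exact hadjab
    set B : Set V := {z | ∃ t, i < t ∧ t < j ∧ f t = z} with hB
    set C : Set V := {z | ∃ t ≤ m + 1, (t < i ∨ j < t) ∧ f t = z} with hC
    have hBP : B ⊆ (P : Set V) := by
      rintro _ ⟨t, _, _, rfl⟩; exact (hmemP _).2 ⟨t, by omega, rfl⟩
    have hCP : C ⊆ (P : Set V) := by
      rintro _ ⟨t, ht, _, rfl⟩; exact (hmemP _).2 ⟨t, ht, rfl⟩
    have hKB : Disjoint (K : Set V) B := Set.disjoint_right.2 fun z hz => hPK z (hBP hz)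
    have hKC : Disjoint (K : Set V) C := Set.disjoint_right.2 fun z hz => hPK z (hCP hz)
    have hBC : Disjoint B C := by
      rw [Set.disjoint_left]
      rintro _ ⟨t, h1, h2, rfl⟩ ⟨t', h3, h4, h5⟩
      have := hinj' t' t h3 (by omega) h5
      omega
    have hiB : f i ∉ B := by
      rintro ⟨t, h1, h2, h3⟩
      have := hinj' t i (by omega) (by omega) h3
      omega
    have hjB : f j ∉ B := by
      rintro ⟨t, h1, h2, h3⟩
      have := hinj' t j (by omega) (by omega) h3
      omega
    have hiC : f i ∉ C := by
      rintro ⟨t, h1, h2, h3⟩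
      have := hinj' t i h1 (by omega) h3
      omega
    have hjC : f j ∉ C := by
      rintro ⟨t, h1, h2, h3⟩
      have := hinj' t j h1 (by omega) h3
      omega
    obtain ⟨c, hcC, hci, hcj⟩ : ∃ c ∈ C, G.Linked (insert (f i) C) c (f i) ∧
        G.Linked (insert (f j) C) c (f j) := by
      have hdown : G.Linked (insert (f j) C) (f (m + 1)) (f j) :=
        (Linked.of_seq hj (fun t h1 h2 => by
          rcases Nat.eq_or_lt_of_le h1 with rfl | h1
          · exact Or.inl rfl
          · exact Or.inr ⟨t, h2, Or.inr h1, rfl⟩) (fun t _ h2 => hf t (by omega))).symm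
      rcases Nat.eq_zero_or_pos i with rfl | hi
      · have hjm : j < m + 1 := by
          by_contra h
          exact hij0 ⟨rfl, by omega⟩
        have hmC : f (m + 1) ∈ C := ⟨m + 1, le_rfl, Or.inr hjm, rfl⟩
        exact ⟨f (m + 1), hmC, .of_adj hedge.symm (Or.inr hmC) (Or.inl rfl), hdown⟩
      · have h0C : f 0 ∈ C := ⟨0, by omega, Or.inl hi, rfl⟩
        refine ⟨f 0, h0C, Linked.of_seq hi.le (fun t h1 h2 => ?_) (fun t _ h2 => hf t (by omega)), ?_⟩
        · rcases Nat.eq_or_lt_of_le h2 with rfl | h2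
          · exact Or.inl rfl
          · exact Or.inr ⟨t, by omega, Or.inl h2, rfl⟩
        · refine Linked.trans (.of_adj hedge (Or.inr h0C) ?_) hdown
          rcases Nat.eq_or_lt_of_le hj with h | h
          · exact Or.inl (by rw [h])
          · exact Or.inr ⟨m + 1, le_rfl, Or.inr h, rfl⟩
    refine D.no_K23 (hfS i (by omega)) (hfS j hj) (hinj i j hij hj) ![K, B, C] ![s, f (i + 1), c]
      ?_ ?_ ?_ ?_ ?_ ?_ ?_
    · intro k
      fin_cases k
      · exact hKS
      · exact hBP.trans hPS
      · exact hCP.trans hPS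
    · intro k
      fin_cases k
      · exact hsK
      · exact ⟨i + 1, by omega, by omega, rfl⟩
      · exact hcC
    · intro k l hkl
      fin_cases k <;> fin_cases l <;> first | exact absurd rfl hkl | skip
      · exact hKB
      · exact hKC
      · exact hKB.symm
      · exact hBC
      · exact hKC.symm
      · exact hBC.symm
    · intro k
      fin_cases k
      · exact hPK _ (hNP hiN)
      · exact hiB
      · exact hiC
    · intro k
      fin_cases k
      · exact hPK _ (hNP hjN)
      · exact hjB
      · exact hjC
    · intro k
      fin_cases k
      · exact hNlink _ hiN
      · exact .of_adj (hf i (by omega)).symm (Or.inr ⟨i + 1, by omega, by omega, rfl⟩) (Or.inl rfl)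
      · exact hci
    · intro k
      fin_cases k
      · exact hNlink _ hjN
      · refine Linked.of_seq (by omega) (fun t h1 h2 => ?_) (fun t _ h2 => hf t (by omega))
        rcases Nat.eq_or_lt_of_le h2 with rfl | h2
        · exact Or.inl rfl
        · exact Or.inr ⟨t, by omega, h2, rfl⟩
      · exact hcj
  have hNclique' : ∀ u ∈ N, ∀ v ∈ N, u ≠ v → G.Adj u v := by
    intro u hu v hv huv
    obtain ⟨i, hi, rfl⟩ := (hmemP u).1 (hNP hu)
    obtain ⟨j, hj, rfl⟩ := (hmemP v).1 (hNP hv)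
    rcases lt_trichotomy i j with hij | rfl | hij
    · exact hNclique i j hij hj hu hv
    · exact absurd rfl huv
    · exact (hNclique j i hij hi hv hu).symm
  have hKT : K ⊂ T := by
    refine Finset.ssubset_iff_subset_ne.2 ⟨Finset.filter_subset _ _, fun h => ?_⟩
    exact hKP (f 1) (h ▸ hfT 1 le_rfl hm) ((hmemP _).2 ⟨1, by omega, rfl⟩)
  refine ih _ (hn ▸ Finset.card_lt_card hKT) K N hKS (hNP.trans hPS)
    (Finset.disjoint_left.2 fun v hv hv' => hKP v hv (hNP hv')) ⟨s, hsK⟩ ?_ hNclique' ?_ rfl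
  · intro v hv u hu hvu
    have hvT : v ∈ T := hKT.1 hv
    by_cases huP : u ∈ P
    · exact Or.inr (Finset.mem_filter.2 ⟨huP, v, hv, hvu⟩)
    · refine Or.inl ((hKmem u).2 ?_)
      have huT : u ∈ T := (hNQ v hvT u hu hvu).resolve_right fun h => huP (hQP h)
      exact ((hKmem v).1 hv).tail ⟨hvu, ⟨hvT, hKP v hv⟩, huT, huP⟩
  -- Three attachments are pairwise adjacent and together with K form a K₄ minor.
  · by_contra hcard
    obtain ⟨x, hx, y, hy, z, hz, hxy, hxz, hyz⟩ := Finset.two_lt_card.1 (not_le.1 hcard)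
    have hadj := hNclique'
    refine D.no_K4 ![{x}, {y}, {z}, K] ![x, y, z, s] ?_ ?_ ?_ ?_
    · intro k
      fin_cases k
      · simpa using hPS (hNP hx)
      · simpa using hPS (hNP hy)
      · simpa using hPS (hNP hz)
      · exact hKS
    · intro k
      fin_cases k <;> simp [hsK]
    · have hlt : ∀ k l : Fin 4, k < l →
          Disjoint ((![{x}, {y}, {z}, K] : Fin 4 → Set V) k)
            ((![{x}, {y}, {z}, K] : Fin 4 → Set V) l) := by
        intro k l hkl
        fin_cases k <;> fin_cases l <;> first | exact absurd hkl (by decide) | skip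
        · exact Set.disjoint_singleton.2 hxy
        · exact Set.disjoint_singleton.2 hxz
        · exact Set.disjoint_singleton_left.2 (hPK x (hNP hx))
        · exact Set.disjoint_singleton.2 hyz
        · exact Set.disjoint_singleton_left.2 (hPK y (hNP hy))
        · exact Set.disjoint_singleton_left.2 (hPK z (hNP hz))
      exact fun k l hkl => (lt_or_gt_of_ne hkl).elim (hlt k l) fun h => (hlt l k h).symm
    · have hlink : ∀ c ∈ N, G.Linked ({c} ∪ (K : Set V)) c s := fun c hc => (hNlink c hc).symm
      have hedge : ∀ u ∈ N, ∀ v ∈ N, u ≠ v → G.Linked ({u} ∪ {v}) u v := fun u hu v hv huv =>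
        .of_adj (hadj u hu v hv huv) (by simp) (by simp)
      intro k l hkl
      fin_cases k <;> fin_cases l <;> first | exact absurd hkl (by decide) | skip
      · exact hedge x hx y hy hxy
      · exact hedge x hx z hz hxz
      · exact hlink x hx
      · exact hedge y hy z hz hyz
      · exact hlink y hy
      · exact hlink z hz

open Classical in
theorem ConeDrawing.exists_reducible {S : Finset V} (D : G.ConeDrawing S) (hS : S.Nonempty)
    (hdeg : ∀ v ∈ S, 2 ≤ (S.filter (G.Adj v)).card) :
    ∃ u ∈ S, ∃ x ∈ S, ∃ v ∈ S, x ≠ v ∧ S.filter (G.Adj u) = {x, v} ∧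
      (G.Adj x v ∨ ∃ y ∈ S, y ≠ u ∧ S.filter (G.Adj v) = {u, y}) :=
  D.exists_reducible_of_root hdeg S ∅ subset_rfl (Finset.empty_subset _)
    (Finset.disjoint_empty_right _) hS (fun _ _ _ hu _ => Or.inl hu) (by simp) (by simp)

end SimpleGraph

/-! ### Cores, bypassing a path, and the main induction. -/

namespace SimpleGraph

variable {V : Type*} {G : SimpleGraph V}

/-- Every vertex of the nonempty set `B` has at least two neighbours in `B`. -/
def IsCore (G : SimpleGraph V) (B : Finset V) : Prop :=
  B.Nonempty ∧ ∀ v ∈ B, ∃ x ∈ B, ∃ y ∈ B, x ≠ y ∧ G.Adj v x ∧ G.Adj v y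

/-- If B induced no cycle, the first vertex of a longest path in B would have a neighbour other than
the second one. In a forest that neighbour is off the path, which could then be extended. Cores
replace cycles in the induction because rerouting them only means adding vertices to a set. -/
theorem IsCore.exists_isCycle {B : Finset V} (hB : G.IsCore B) :
    ∃ (v : V) (p : G.Walk v v), p.IsCycle ∧ ∀ z ∈ p.support, z ∈ B := by
  classical
  let H := G.induce (B : Set V)
  have hH : ¬ H.IsAcyclic := by
    intro hac
    obtain ⟨b, hb⟩ := hB.1
    have hex : ∃ n, ∃ (u v : (B : Set V)) (p : H.Walk u v), p.IsPath ∧ p.length = n :=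
      ⟨0, ⟨b, hb⟩, ⟨b, hb⟩, .nil, by simp, rfl⟩
    have hbd : ∀ n, (∃ (u v : (B : Set V)) (p : H.Walk u v), p.IsPath ∧ p.length = n) →
        n ≤ Fintype.card (B : Set V) := by
      rintro n ⟨u, v, p, hp, rfl⟩
      exact hp.length_lt.le
    obtain ⟨n, hn⟩ := hex
    obtain ⟨u, v, p, hp, hlen⟩ := Nat.findGreatest_spec
      (P := fun n => ∃ (u v : (B : Set V)) (p : H.Walk u v), p.IsPath ∧ p.length = n) (hbd n hn) hn
    obtain ⟨x, hx, y, hy, hxy, hux, huy⟩ := hB.2 u u.2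
    obtain ⟨z, hz, huz⟩ : ∃ z : (B : Set V), z ≠ p.snd ∧ H.Adj u z := by
      by_cases h : (⟨x, hx⟩ : (B : Set V)) = p.snd
      · exact ⟨⟨y, hy⟩, fun h' => hxy (Subtype.mk.inj (h.trans h'.symm)), huy⟩
      · exact ⟨⟨x, hx⟩, h, hux⟩
    have hzs : z ∉ p.support := fun h => hz (hac.eq_snd_of_adj_start hp huz h)
    have hlong : (Walk.cons huz.symm p).IsPath := hp.cons hzs
    have := Nat.le_findGreatest
      (P := fun n => ∃ (u v : (B : Set V)) (p : H.Walk u v), p.IsPath ∧ p.length = n)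
      (hbd _ ⟨_, _, _, hlong, rfl⟩) ⟨_, _, _, hlong, rfl⟩
    rw [Walk.length_cons] at this
    omega
  simp only [IsAcyclic, not_forall, not_not] at hH
  obtain ⟨v, p, hp⟩ := hH
  let φ : H ↪g G := Embedding.induce (B : Set V)
  refine ⟨φ.toHom v, p.map φ.toHom, hp.map φ.injective, fun z hz => ?_⟩
  rw [Walk.support_map, List.mem_map] at hz
  obtain ⟨w, -, rfl⟩ := hz
  exact w.2

/-- A family of pairwise disjoint cores yields equally many vertex-disjoint cycles. -/
theorem exists_isDisjointCycleCollection {C : Finset (Finset V)} (hC : ∀ B ∈ C, G.IsCore B)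
    (hd : (C : Set (Finset V)).PairwiseDisjoint id) :
    ∃ C' : Finset G.Subgraph, G.IsDisjointCycleCollection C' ∧ C'.card = C.card := by
  classical
  have h : ∀ B ∈ C, ∃ H : G.Subgraph, (∃ (v : V) (p : G.Walk v v), p.IsCycle ∧ p.toSubgraph = H) ∧
      H.verts.Nonempty ∧ H.verts ⊆ B := fun B hB => by
    obtain ⟨v, p, hp, hs⟩ := (hC B hB).exists_isCycle
    exact ⟨p.toSubgraph, ⟨v, p, hp, rfl⟩, ⟨v, by simp⟩, fun z hz => hs z (by simpa using hz)⟩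
  choose! F hF using h
  have hdisj : ∀ B ∈ C, ∀ B' ∈ C, B ≠ B' → Disjoint (F B).verts (F B').verts :=
    fun B hB B' hB' hne => Set.disjoint_of_subset (hF B hB).2.2 (hF B' hB').2.2
      (Finset.disjoint_coe.2 (hd hB hB' hne))
  have hinj : Set.InjOn F C := fun B hB B' hB' heq => by
    by_contra hne
    have := hdisj B hB B' hB' hne
    rw [heq, disjoint_self] at this
    exact (hF B' hB').2.1.ne_empty this
  refine ⟨C.image F, ⟨?_, ?_⟩, Finset.card_image_of_injOn hinj⟩
  · intro H hH
    obtain ⟨B, hB, rfl⟩ := Finset.mem_image.1 hH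
    exact (hF B hB).1
  · intro H hH H' hH' hne
    obtain ⟨B, hB, rfl⟩ := Finset.mem_image.1 hH
    obtain ⟨B', hB', rfl⟩ := Finset.mem_image.1 hH'
    exact hdisj B hB B' hB' fun h => hne (h ▸ rfl)

namespace ConeDrawing

/-- Restriction of a cone drawing to fewer vertices. -/
def restrict {S T : Finset V} (D : G.ConeDrawing S) (h : T ⊆ S) : G.ConeDrawing T where
  point := D.point
  arc := D.arc
  apex := D.apex
  ray := D.ray
  joinedIn_arc u hu v hv := D.joinedIn_arc u (h hu) v (h hv)
  joinedIn_ray v hv := D.joinedIn_ray v (h hv)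
  point_ne u hu v hv := D.point_ne u (h hu) v (h hv)
  point_notMem_arc w hw u hu v hv := D.point_notMem_arc w (h hw) u (h hu) v (h hv)
  disjoint_arc a ha b hb c hc d hd := D.disjoint_arc a (h ha) b (h hb) c (h hc) d (h hd)
  point_notMem_ray w hw v hv := D.point_notMem_ray w (h hw) v (h hv)
  disjoint_ray w hw u hu v hv := D.disjoint_ray w (h hw) u (h hu) v (h hv)

open Classical in
/-- Replacing a path `x u v y` by an edge `x y`. -/
noncomputable def bypass {S : Finset V} (D : G.ConeDrawing S) {x u v y : V} (hx : x ∈ S)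
    (hu : u ∈ S) (hv : v ∈ S) (hy : y ∈ S) (hxu : G.Adj x u) (huv : G.Adj u v) (hvy : G.Adj v y) :
    (G ⊔ edge x y).ConeDrawing (S \ {u, v}) :=
  have hmem : ∀ w ∈ S \ {u, v}, w ∈ S ∧ w ≠ u ∧ w ≠ v := fun w hw => by simpa using hw
  have hadj : ∀ {a b}, (G ⊔ edge x y).Adj a b → s(a, b) ≠ s(x, y) → G.Adj a b := fun {a b} h hne => by
    rcases h with h | h
    · exact h
    · rw [edge_adj] at h
      exact absurd (Sym2.eq_iff.2 h.1) hne
  have hlr : ∀ {w a b}, w ≠ a → w ≠ b → s(a, b) = s(x, y) → w ≠ x ∧ w ≠ y := fun {w a b} ha hb h => by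
    rcases Sym2.eq_iff.1 h with ⟨rfl, rfl⟩ | ⟨rfl, rfl⟩
    · exact ⟨ha, hb⟩
    · exact ⟨hb, ha⟩
  have hdis : ∀ c ∈ S \ {u, v}, ∀ d ∈ S \ {u, v}, G.Adj c d → c ≠ x → d ≠ x → c ≠ y → d ≠ y →
      Disjoint (D.arc s(x, u) ∪ D.arc s(u, v) ∪ D.arc s(v, y)) (D.arc s(c, d)) := by
    intro c hc d hd hcd hcx hdx hcy hdy
    obtain ⟨hcS, hcu, hcv⟩ := hmem c hc
    obtain ⟨hdS, hdu, hdv⟩ := hmem d hd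
    simp only [Set.disjoint_union_left]
    exact ⟨⟨D.disjoint_arc x hx u hu c hcS d hdS hxu hcd hcx.symm hdx.symm hcu.symm hdu.symm,
      D.disjoint_arc u hu v hv c hcS d hdS huv hcd hcu.symm hdu.symm hcv.symm hdv.symm⟩,
      D.disjoint_arc v hv y hy c hcS d hdS hvy hcd hcv.symm hdv.symm hcy.symm hdy.symm⟩
  { point := D.point
    -- The arc at `s(x, y)` is overwritten even if x y is already an edge of G.
    arc := fun e => if e = s(x, y) then D.arc s(x, u) ∪ D.arc s(u, v) ∪ D.arc s(v, y) else D.arc e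
    apex := D.apex
    ray := D.ray
    joinedIn_arc := by
      intro a ha b hb hab
      split_ifs with h
      · have hj : JoinedIn (D.arc s(x, u) ∪ D.arc s(u, v) ∪ D.arc s(v, y)) (D.point x)
            (D.point y) :=
          (((D.joinedIn_arc x hx u hu hxu).mono (fun z hz => Or.inl (Or.inl hz))).trans
            ((D.joinedIn_arc u hu v hv huv).mono (fun z hz => Or.inl (Or.inr hz)))).trans
            ((D.joinedIn_arc v hv y hy hvy).mono (fun z hz => Or.inr hz))
        rcases Sym2.eq_iff.1 h with ⟨rfl, rfl⟩ | ⟨rfl, rfl⟩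
        · exact hj
        · exact hj.symm
      · exact D.joinedIn_arc a (hmem a ha).1 b (hmem b hb).1 (hadj hab h)
    joinedIn_ray := fun w hw => D.joinedIn_ray w (hmem w hw).1
    point_ne := fun a ha b hb => D.point_ne a (hmem a ha).1 b (hmem b hb).1
    point_notMem_arc := by
      intro w hw a ha b hb hab hwa hwb
      obtain ⟨hwS, hwu, hwv⟩ := hmem w hw
      split_ifs with h
      · obtain ⟨hwx, hwy⟩ := hlr hwa hwb h
        rintro ((hz | hz) | hz)
        · exact D.point_notMem_arc w hwS x hx u hu hxu hwx hwu hz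
        · exact D.point_notMem_arc w hwS u hu v hv huv hwu hwv hz
        · exact D.point_notMem_arc w hwS v hv y hy hvy hwv hwy hz
      · exact D.point_notMem_arc w hwS a (hmem a ha).1 b (hmem b hb).1 (hadj hab h) hwa hwb
    disjoint_arc := by
      intro a ha b hb c hc d hd hab hcd hac had hbc hbd
      by_cases h : s(a, b) = s(x, y) <;> by_cases h' : s(c, d) = s(x, y)
      · have : a ∈ s(c, d) := by rw [h', ← h]; simp
        rcases Sym2.mem_iff.1 this with rfl | rfl
        · exact absurd rfl hac
        · exact absurd rfl had
      · rw [if_pos h, if_neg h']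
        obtain ⟨h1, h2⟩ := hlr hac.symm hbc.symm h
        obtain ⟨h3, h4⟩ := hlr had.symm hbd.symm h
        exact hdis c hc d hd (hadj hcd h') h1 h3 h2 h4
      · rw [if_neg h, if_pos h']
        obtain ⟨h1, h2⟩ := hlr hac had h'
        obtain ⟨h3, h4⟩ := hlr hbc hbd h'
        exact (hdis a ha b hb (hadj hab h) h1 h3 h2 h4).symm
      · rw [if_neg h, if_neg h']
        exact D.disjoint_arc a (hmem a ha).1 b (hmem b hb).1 c (hmem c hc).1 d (hmem d hd).1
          (hadj hab h) (hadj hcd h') hac had hbc hbd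
    point_notMem_ray := fun w hw a ha => D.point_notMem_ray w (hmem w hw).1 a (hmem a ha).1
    disjoint_ray := by
      intro w hw a ha b hb hab hwa hwb
      obtain ⟨hwS, hwu, hwv⟩ := hmem w hw
      split_ifs with h
      · obtain ⟨hwx, hwy⟩ := hlr hwa hwb h
        simp only [Set.disjoint_union_right]
        exact ⟨⟨D.disjoint_ray w hwS x hx u hu hxu hwx hwu,
          D.disjoint_ray w hwS u hu v hv huv hwu hwv⟩,
          D.disjoint_ray w hwS v hv y hy hvy hwv hwy⟩
      · exact D.disjoint_ray w hwS a (hmem a ha).1 b (hmem b hb).1 (hadj hab h) hwa hwb }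

end ConeDrawing

open Classical in
theorem IsIndepSet.insert_finset {I : Finset V} (hI : G.IsIndepSet (I : Set V)) {v : V}
    (hv : ∀ w ∈ I, ¬ G.Adj v w) : G.IsIndepSet ((insert v I : Finset V) : Set V) := by
  rw [Finset.coe_insert]
  refine Set.Pairwise.insert hI fun w hw _ => ⟨hv w hw, fun h => hv w hw h.symm⟩

open Classical in
/-- Replacing the edge `x y` by a path `x u v y` in a family of disjoint cores. -/
theorem exists_cores_of_sup_edge {S : Finset V} {x u v y : V} (hu : u ∉ S) (hv : v ∉ S)
    (hxu : G.Adj x u) (huv : G.Adj u v) (hvy : G.Adj v y) (hxv : x ≠ v) (hyu : y ≠ u)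
    {C : Finset (Finset V)} (hC : ∀ B ∈ C, B ⊆ S ∧ (G ⊔ edge x y).IsCore B)
    (hd : (C : Set (Finset V)).PairwiseDisjoint id) :
    ∃ C' : Finset (Finset V), (∀ B ∈ C', B ⊆ insert u (insert v S) ∧ G.IsCore B) ∧
      (C' : Set (Finset V)).PairwiseDisjoint id ∧ C'.card = C.card := by
  let F : Finset V → Finset V := fun B => if x ∈ B ∧ y ∈ B then insert u (insert v B) else B
  have hFsub : ∀ B, F B ⊆ insert u (insert v B) := fun B => by
    dsimp only [F]
    split_ifs
    · exact subset_rfl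
    · exact (Finset.subset_insert _ _).trans (Finset.subset_insert _ _)
  have hsub : ∀ B, B ⊆ F B := fun B => by
    dsimp only [F]
    split_ifs
    · exact (Finset.subset_insert _ _).trans (Finset.subset_insert _ _)
    · exact subset_rfl
  have hFx : ∀ B ∈ C, ∀ z ∈ F B, z ∉ B → x ∈ B ∧ (z = u ∨ z = v) := fun B hB z hz hzB => by
    dsimp only [F] at hz
    split_ifs at hz with h
    · exact ⟨h.1, by simpa [hzB] using hz⟩
    · exact absurd hz hzB
  -- Only a core containing x is enlarged, and disjoint cores cannot both contain x.
  have hFd : ∀ B ∈ C, ∀ B' ∈ C, B ≠ B' → Disjoint (F B) (F B') := fun B hB B' hB' hne => by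
    have hBB := Finset.disjoint_left.1 (hd hB hB' hne : Disjoint B B')
    rw [Finset.disjoint_left]
    intro z hz hz'
    have huv' : ∀ B ∈ C, z = u ∨ z = v → z ∉ B := fun B hB h hzB => by
      rcases h with rfl | rfl
      · exact hu ((hC B hB).1 hzB)
      · exact hv ((hC B hB).1 hzB)
    by_cases h : z ∈ B
    · by_cases h' : z ∈ B'
      · exact hBB h h'
      · exact huv' B hB (hFx B' hB' z hz' h').2 h
    · by_cases h' : z ∈ B'
      · exact huv' B' hB' (hFx B hB z hz h).2 h'
      · exact hBB (hFx B hB z hz h).1 (hFx B' hB' z hz' h').1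
  have hinj : Set.InjOn F C := fun B hB B' hB' heq => by
    by_contra hne
    have := hFd B hB B' hB' hne
    rw [heq, disjoint_self] at this
    obtain ⟨z, hz⟩ := (hC B' hB').2.1
    have := hsub B' hz
    simp_all
  refine ⟨C.image F, ?_, ?_, Finset.card_image_of_injOn hinj⟩
  · intro B' hB'
    obtain ⟨B, hB, rfl⟩ := Finset.mem_image.1 hB'
    refine ⟨(hFsub B).trans (Finset.insert_subset_insert _ (Finset.insert_subset_insert _
      (hC B hB).1)), (hC B hB).2.1.mono (hsub B), ?_⟩
    have hold : ∀ a b, (G ⊔ edge x y).Adj a b → G.Adj a b ∨ (a = x ∧ b = y ∨ a = y ∧ b = x) := by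
      rintro a b (h | h)
      · exact Or.inl h
      · rw [edge_adj] at h
        exact Or.inr h.1
    dsimp only [F]
    split_ifs with h
    · have huB : u ∉ B := fun h => hu ((hC B hB).1 h)
      have hvB : v ∉ B := fun h => hv ((hC B hB).1 h)
      -- the neighbour of `w` that replaces `z`
      have hrep : ∀ w ∈ B, ∀ z ∈ B, (G ⊔ edge x y).Adj w z →
          ∃ z' ∈ insert u (insert v B), G.Adj w z' ∧ (z' = z ∨ (w = x ∧ z = y ∧ z' = u) ∨
            (w = y ∧ z = x ∧ z' = v)) := fun w hw z hz hwz => by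
        rcases hold w z hwz with h | ⟨rfl, rfl⟩ | ⟨rfl, rfl⟩
        · exact ⟨z, by simp [hz], h, Or.inl rfl⟩
        · exact ⟨u, by simp, hxu, by simp⟩
        · exact ⟨v, by simp, hvy.symm, by simp⟩
      intro w hw
      rcases Finset.mem_insert.1 hw with rfl | hw
      · exact ⟨x, by simp [h.1], v, by simp, hxv, hxu.symm, huv⟩
      rcases Finset.mem_insert.1 hw with rfl | hw
      · exact ⟨u, by simp, y, by simp [h.2], hyu.symm, huv.symm, hvy⟩
      obtain ⟨a, ha, b, hb, hab, hwa, hwb⟩ := (hC B hB).2.2 w hw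
      obtain ⟨a', ha', hwa', hca⟩ := hrep w hw a ha hwa
      obtain ⟨b', hb', hwb', hcb⟩ := hrep w hw b hb hwb
      refine ⟨a', ha', b', hb', ?_, hwa', hwb'⟩
      -- As u and v are distinct and outside B, replaced neighbours coincide only if the original
      -- ones did.
      rintro rfl
      rcases hca with rfl | ⟨_, rfl, rfl⟩ | ⟨_, rfl, rfl⟩ <;>
        rcases hcb with h1 | ⟨_, h1, h2⟩ | ⟨_, h1, h2⟩ <;>
        simp_all
    · intro w hw
      obtain ⟨a, ha, b, hb, hab, hwa, hwb⟩ := (hC B hB).2.2 w hw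
      have hkeep : ∀ z ∈ B, (G ⊔ edge x y).Adj w z → G.Adj w z := fun z hz hwz => by
        rcases hold w z hwz with h' | ⟨rfl, rfl⟩ | ⟨rfl, rfl⟩
        · exact h'
        · exact absurd ⟨hw, hz⟩ h
        · exact absurd ⟨hz, hw⟩ h
      exact ⟨a, ha, b, hb, hab, hkeep a ha hwa, hkeep b hb hwb⟩
  · intro B₁ h₁ B₂ h₂ hne
    obtain ⟨B, hB, rfl⟩ := Finset.mem_image.1 h₁
    obtain ⟨B', hB', rfl⟩ := Finset.mem_image.1 h₂
    exact hFd B hB B' hB' fun h => hne (h ▸ rfl)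

-- Strong induction on |S| with G varying, since the bypass adds an edge. The three cases are a
-- triangle with a vertex of degree two, a path through two adjacent vertices of degree two, and a
-- vertex of degree at most one.
open Classical in
theorem ConeDrawing.exists_indepSet_and_cores {S : Finset V} (D : G.ConeDrawing S) :
    ∃ (I : Finset V) (C : Finset (Finset V)), I ⊆ S ∧ G.IsIndepSet (I : Set V) ∧
      (∀ B ∈ C, B ⊆ S ∧ G.IsCore B) ∧ (C : Set (Finset V)).PairwiseDisjoint id ∧
      4 * S.card ≤ 9 * I.card + 3 * C.card := by
  induction hn : S.card using Nat.strong_induction_on generalizing S G with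
  | _ n ih =>
  subst hn
  rcases S.eq_empty_or_nonempty with rfl | hS
  · exact ⟨∅, ∅, by simp, by simp [IsIndepSet], by simp, by simp, by simp⟩
  by_cases hdeg : ∀ v ∈ S, 2 ≤ (S.filter (G.Adj v)).card
  · obtain ⟨u, hu, x, hx, v, hv, hxv, hNu, hcase⟩ := D.exists_reducible hS hdeg
    have hux : G.Adj u x := (Finset.mem_filter.1 (hNu.symm ▸ by simp : x ∈ S.filter (G.Adj u))).2
    have huv : G.Adj u v := (Finset.mem_filter.1 (hNu.symm ▸ by simp : v ∈ S.filter (G.Adj u))).2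
    have hNu' : ∀ w ∈ S, G.Adj u w → w = x ∨ w = v := fun w hw huw => by
      have : w ∈ S.filter (G.Adj u) := Finset.mem_filter.2 ⟨hw, huw⟩
      simpa [hNu] using this
    by_cases hadj : G.Adj x v
    · have hcard : ({u, x, v} : Finset V).card = 3 :=
        Finset.card_eq_three.2 ⟨u, x, v, hux.ne, huv.ne, hxv, rfl⟩
      have hsub : ({u, x, v} : Finset V) ⊆ S := by
        simp [Finset.insert_subset_iff, hu, hx, hv]
      have hle : 3 ≤ S.card := hcard ▸ Finset.card_le_card hsub
      have hScard : (S \ {u, x, v}).card = S.card - 3 := by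
        rw [Finset.card_sdiff_of_subset hsub, hcard]
      obtain ⟨I, C, hIS, hI, hC, hd, hb⟩ := ih _ (by omega)
        (D.restrict (Finset.sdiff_subset (s := S) (t := {u, x, v}))) rfl
      have hIu : u ∉ I := fun h => by simpa using hIS h
      have hnew : ∀ B ∈ C, Disjoint {u, x, v} B := fun B hB =>
        Finset.disjoint_of_subset_right (hC B hB).1 Finset.disjoint_sdiff
      have hCu : {u, x, v} ∉ C := fun h => by
        have := hnew _ h
        rw [disjoint_self] at this
        simp at this
      refine ⟨insert u I, insert {u, x, v} C,
        Finset.insert_subset hu (hIS.trans Finset.sdiff_subset), hI.insert_finset ?_, ?_, ?_, ?_⟩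
      · intro w hw huw
        have := Finset.mem_sdiff.1 (hIS hw)
        rcases hNu' w this.1 huw with rfl | rfl <;> simp at this
      · intro B hB
        rcases Finset.mem_insert.1 hB with rfl | hB
        · refine ⟨hsub, ⟨u, by simp⟩, ?_⟩
          intro w hw
          simp only [Finset.mem_insert, Finset.mem_singleton] at hw
          rcases hw with rfl | rfl | rfl
          · exact ⟨x, by simp, v, by simp, hxv, hux, huv⟩
          · exact ⟨u, by simp, v, by simp, huv.ne, hux.symm, hadj⟩
          · exact ⟨u, by simp, x, by simp, hux.ne, huv.symm, hadj.symm⟩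
        · exact ⟨(hC B hB).1.trans Finset.sdiff_subset, (hC B hB).2⟩
      · rw [Finset.coe_insert]
        exact hd.insert fun B hB _ => hnew B hB
      · rw [Finset.card_insert_of_notMem hIu, Finset.card_insert_of_notMem hCu]
        omega
    · obtain ⟨y, hy, hyu, hNv⟩ := hcase.resolve_left hadj
      have hvy : G.Adj v y := (Finset.mem_filter.1 (hNv.symm ▸ by simp : y ∈ S.filter (G.Adj v))).2
      have hNv' : ∀ w ∈ S, G.Adj v w → w = u ∨ w = y := fun w hw huw => by
        have : w ∈ S.filter (G.Adj v) := Finset.mem_filter.2 ⟨hw, huw⟩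
        simpa [hNv] using this
      have hxy : x ≠ y := fun h => hadj (h ▸ hvy.symm)
      have hcard : ({u, v} : Finset V).card = 2 := Finset.card_pair huv.ne
      have hsub : ({u, v} : Finset V) ⊆ S := by simp [Finset.insert_subset_iff, hu, hv]
      have hle : 2 ≤ S.card := hcard ▸ Finset.card_le_card hsub
      have hScard : (S \ {u, v}).card = S.card - 2 := by
        rw [Finset.card_sdiff_of_subset hsub, hcard]
      obtain ⟨I, C, hIS, hI, hC, hd, hb⟩ := ih _ (by omega)
        (D.bypass hx hu hv hy hux.symm huv hvy) rfl
      obtain ⟨C', hC', hd', hcard'⟩ := exists_cores_of_sup_edge (S := S \ {u, v}) (by simp)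
        (by simp) hux.symm huv hvy hxv hyu hC hd
      have hS' : insert u (insert v (S \ {u, v})) ⊆ S :=
        Finset.insert_subset hu (Finset.insert_subset hv Finset.sdiff_subset)
      have hIG : G.IsIndepSet (I : Set V) := fun a ha b hb hab h => hI ha hb hab (Or.inl h)
      have hIu : u ∉ I := fun h => by simpa using hIS h
      have hIv : v ∉ I := fun h => by simpa using hIS h
      have hIS' : I ⊆ S := hIS.trans Finset.sdiff_subset
      have hC'' : ∀ B ∈ C', B ⊆ S ∧ G.IsCore B := fun B hB =>
        ⟨(hC' B hB).1.trans hS', (hC' B hB).2⟩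
      by_cases hxI : x ∈ I
      -- I is independent for the graph with the edge x y. With x in I, v may be added; otherwise u
      -- may.
      · have hyI : y ∉ I := fun hyI => hI hxI hyI hxy (Or.inr (by simp [edge_adj, hxy]))
        refine ⟨insert v I, C', Finset.insert_subset hv hIS', hIG.insert_finset ?_, hC'', hd', ?_⟩
        · intro w hw hvw
          rcases hNv' w (hIS' hw) hvw with rfl | rfl
          · exact hIu hw
          · exact hyI hw
        · rw [Finset.card_insert_of_notMem hIv]
          omega
      · refine ⟨insert u I, C', Finset.insert_subset hu hIS', hIG.insert_finset ?_, hC'', hd', ?_⟩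
        · intro w hw huw
          rcases hNu' w (hIS' hw) huw with rfl | rfl
          · exact hxI hw
          · exact hIv hw
        · rw [Finset.card_insert_of_notMem hIu]
          omega
  · push Not at hdeg
    obtain ⟨v, hv, hlt⟩ := hdeg
    set R := insert v (S.filter (G.Adj v)) with hR
    have hRS : R ⊆ S := Finset.insert_subset hv (Finset.filter_subset _ _)
    have hR2 : R.card ≤ 2 := (Finset.card_insert_le _ _).trans (by omega)
    have hRpos : 0 < R.card := Finset.card_pos.2 ⟨v, by simp [hR]⟩
    have hScard : (S \ R).card = S.card - R.card := Finset.card_sdiff_of_subset hRS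
    have hle : R.card ≤ S.card := Finset.card_le_card hRS
    obtain ⟨I, C, hIS, hI, hC, hd, hb⟩ := ih _ (by omega)
      (D.restrict (Finset.sdiff_subset (s := S) (t := R))) rfl
    have hIv : v ∉ I := fun h => by simpa [hR] using hIS h
    refine ⟨insert v I, C, Finset.insert_subset hv (hIS.trans Finset.sdiff_subset),
      hI.insert_finset ?_, fun B hB => ⟨(hC B hB).1.trans Finset.sdiff_subset, (hC B hB).2⟩, hd, ?_⟩
    · intro w hw hvw
      have := Finset.mem_sdiff.1 (hIS hw)
      exact this.2 (Finset.mem_insert_of_mem (Finset.mem_filter.2 ⟨this.1, hvw⟩))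
    · rw [Finset.card_insert_of_notMem hIv]
      omega

end SimpleGraph

/-! ### From an outerplanar drawing to a cone drawing. -/

namespace SimpleGraph

/-- The exterior of a disc in the plane is connected. -/
theorem isPreconnected_setOf_lt_norm {M : ℝ} (hM : 0 ≤ M) :
    IsPreconnected {z : ℝ × ℝ | M < ‖z‖} := by
  have hs : IsPreconnected (Metric.sphere (0 : ℝ × ℝ) 1) :=
    isPreconnected_sphere (by
      rw [rank_prod', Module.rank_self, one_add_one_eq_two]; exact_mod_cast one_lt_two) 0 1
  have himg : {z : ℝ × ℝ | M < ‖z‖} =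
      (fun q : (ℝ × ℝ) × ℝ => q.2 • q.1) '' (Metric.sphere (0 : ℝ × ℝ) 1 ×ˢ Set.Ioi M) := by
    ext z
    constructor
    · intro hz
      have hz' : M < ‖z‖ := hz
      have hpos : ‖z‖ ≠ 0 := (hM.trans_lt hz').ne'
      refine ⟨(‖z‖⁻¹ • z, ‖z‖), ⟨?_, hz⟩, ?_⟩
      · simp [norm_smul, hpos]
      · simp [smul_smul, hpos]
    · rintro ⟨⟨x, r⟩, ⟨hx, hr⟩, rfl⟩
      have hx' : ‖x‖ = 1 := by simpa using hx
      have hr' : M < r := hr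
      simpa [norm_smul, hx', abs_of_pos (hM.trans_lt hr')] using hr'
  rw [himg]
  exact (hs.prod isPreconnected_Ioi).image _ (by fun_prop)

namespace PlaneDrawing

variable {V : Type*} {G : SimpleGraph V} (D : G.PlaneDrawing)

theorem isCompact_arc {e : Sym2 V} (he : e ∈ G.edgeSet) : IsCompact (D.arc e) := by
  induction e using Sym2.ind with
  | _ u v =>
    obtain ⟨γ, -, hγ⟩ := D.isArc u v he
    exact hγ ▸ isCompact_range γ.continuous

theorem isCompact_carrier [Finite V] : IsCompact D.carrier :=
  (Set.finite_range _).isCompact.union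
    ((Set.toFinite G.edgeSet).isCompact_biUnion fun _ he => D.isCompact_arc he)

/-- The outer face is contained in a path connected subset of the complement of the drawing. -/
theorem exists_isPathConnected_superset_outerFace [Finite V] :
    ∃ U : Set (ℝ × ℝ), IsPathConnected U ∧ U ⊆ D.carrierᶜ ∧ D.outerFace ⊆ U := by
  obtain ⟨M, hM0, hM⟩ := D.isCompact_carrier.isBounded.subset_closedBall_lt 0 0
  have hE : {z : ℝ × ℝ | M < ‖z‖} ⊆ D.carrierᶜ := fun z hz hz' => by
    have := hM hz'
    rw [mem_closedBall_zero_iff] at this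
    exact absurd hz (not_lt.2 this)
  have hw : ((M + 1, 0) : ℝ × ℝ) ∈ {z : ℝ × ℝ | M < ‖z‖} := by
    simp only [Set.mem_ofPred_eq, Prod.norm_def, Real.norm_eq_abs]
    exact lt_max_of_lt_left (by rw [abs_of_pos (by linarith)]; linarith)
  have hopen : IsOpen D.carrierᶜ := D.isCompact_carrier.isClosed.isOpen_compl
  refine ⟨connectedComponentIn D.carrierᶜ (M + 1, 0), ?_, connectedComponentIn_subset _ _, ?_⟩
  · rw [← (hopen.connectedComponentIn).isConnected_iff_isPathConnected]
    exact isConnected_connectedComponentIn_iff.2 (hE hw)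
  -- An unbounded component leaves the ball, so it meets the connected exterior and is the component
  -- of the far point.
  · rintro z ⟨hz, hunb⟩
    obtain ⟨z', hz', hnorm⟩ : ∃ z' ∈ connectedComponentIn D.carrierᶜ z, M < ‖z'‖ := by
      by_contra hcon
      push Not at hcon
      exact hunb (Metric.isBounded_closedBall.subset fun z' hz' =>
        mem_closedBall_zero_iff.2 (hcon z' hz'))
    have hz'U : z' ∈ connectedComponentIn D.carrierᶜ (M + 1, 0) :=
      (isPreconnected_setOf_lt_norm hM0.le).subset_connectedComponentIn hw hE hnorm
    rw [connectedComponentIn_eq hz'U, ← connectedComponentIn_eq hz']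
    exact mem_connectedComponentIn hz

theorem point_mem_carrier (v : V) : D.point v ∈ D.carrier := Or.inl ⟨v, rfl⟩

theorem arc_subset_carrier {e : Sym2 V} (he : e ∈ G.edgeSet) : D.arc e ⊆ D.carrier :=
  fun _ hz => Or.inr (Set.mem_biUnion he hz)

/-- A plane drawing with all vertices on the outer face extends to a drawing of the cone. -/
theorem nonempty_coneDrawing [Fintype V] (hD : ∀ v, D.point v ∈ frontier D.outerFace) :
    Nonempty (G.ConeDrawing Finset.univ) := by
  obtain ⟨U, hU, hUc, hUo⟩ := D.exists_isPathConnected_superset_outerFace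
  obtain ⟨w, hw⟩ := hU.nonempty
  have hball : ∀ v, ∃ ε > 0, (∀ u, u ≠ v → D.point u ∉ Metric.ball (D.point v) ε) ∧
      ∀ e ∈ G.edgeSet, v ∉ e → Disjoint (Metric.ball (D.point v) ε) (D.arc e) := fun v => by
    have hclosed : IsClosed (D.point '' {u | u ≠ v} ∪ ⋃ e ∈ {e ∈ G.edgeSet | v ∉ e}, D.arc e) :=
      ((Set.toFinite _).image _).isClosed.union
        ((Set.toFinite _).isClosed_biUnion fun e he => (D.isCompact_arc he.1).isClosed)
    have hv : D.point v ∉ D.point '' {u | u ≠ v} ∪ ⋃ e ∈ {e ∈ G.edgeSet | v ∉ e}, D.arc e := by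
      rintro (⟨u, hu, huv⟩ | h)
      · exact hu (D.point_injective huv)
      · obtain ⟨e, he, hz⟩ := Set.mem_iUnion₂.1 h
        exact he.2 (D.mem_of_point_mem_arc e he.1 v hz)
    obtain ⟨ε, hε, hsub⟩ := Metric.isOpen_iff.1 hclosed.isOpen_compl _ hv
    refine ⟨ε, hε, fun u hu h => hsub h (Or.inl ⟨u, hu, rfl⟩), fun e he hve => ?_⟩
    exact Set.disjoint_left.2 fun z hz hz' =>
      hsub hz (Or.inr (Set.mem_biUnion (⟨he, hve⟩ : e ∈ {e ∈ G.edgeSet | v ∉ e}) hz'))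
  choose ε hε hpt harc using hball
  have hne : ∀ {a u v : V}, a ≠ u → a ≠ v → a ∉ s(u, v) := fun h1 h2 h =>
    (Sym2.mem_iff.1 h).elim h1 h2
  refine ⟨{
    point := D.point
    arc := D.arc
    apex := w
    -- The ball misses the other vertices and every arc not ending at v, and it meets U because v is
    -- on the frontier of the outer face. Rays overlap one another and may meet arcs at v, which a
    -- cone drawing permits.
    ray := fun v => U ∪ Metric.ball (D.point v) (ε v)
    joinedIn_arc := ?_
    joinedIn_ray := ?_
    point_ne := fun u _ v _ huv h => huv (D.point_injective h)
    point_notMem_arc := fun w _ u _ v _ huv h1 h2 h =>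
      hne h1 h2 (D.mem_of_point_mem_arc s(u, v) huv w h)
    disjoint_arc := ?_
    point_notMem_ray := ?_
    disjoint_ray := ?_ }⟩
  · intro u _ v _ huv
    obtain ⟨γ, -, hγ⟩ := D.isArc u v huv
    exact ⟨γ, fun t => hγ ▸ Set.mem_range_self t⟩
  · intro v _
    obtain ⟨z, hz, hzU⟩ := Metric.mem_closure_iff.1 (frontier_subset_closure (hD v)) (ε v) (hε v)
    have h1 : JoinedIn (U ∪ Metric.ball (D.point v) (ε v)) w z :=
      (hU.joinedIn w hw z (hUo hz)).mono Set.subset_union_left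
    have h2 : JoinedIn (U ∪ Metric.ball (D.point v) (ε v)) z (D.point v) :=
      ((Metric.isPathConnected_ball (hε v)).joinedIn z (by rwa [Metric.mem_ball, _root_.dist_comm]) _
        (Metric.mem_ball_self (hε v))).mono Set.subset_union_right
    exact h1.trans h2
  · intro a _ b _ c _ d _ hab hcd hac had hbc hbd
    refine Set.disjoint_left.2 fun z hz hz' => ?_
    have hne' : s(a, b) ≠ s(c, d) := fun h => hne hac had (h ▸ Sym2.mem_mk_left a b)
    obtain ⟨x, hx, hx', -⟩ := D.arc_inter_arc _ hab _ hcd hne' z ⟨hz, hz'⟩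
    rcases Sym2.mem_iff.1 hx with rfl | rfl
    · exact hne hac had hx'
    · exact hne hbc hbd hx'
  · rintro a _ v _ hav (h | h)
    · exact hUc h (D.point_mem_carrier a)
    · exact hpt v a hav h
  · intro a _ u _ v _ huv h1 h2
    rw [Set.disjoint_union_left]
    exact ⟨Set.disjoint_left.2 fun z hz hz' => hUc hz (D.arc_subset_carrier huv hz'),
      harc a _ huv (hne h1 h2)⟩

end PlaneDrawing

end SimpleGraph

/-! ### Tightness: disjoint triangles. -/

namespace SimpleGraph

theorem card_le_of_isIndepSet_disjointTriangles {k : ℕ} {I : Finset (Fin k × Fin 3)}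
    (hI : (disjointTriangles k).IsIndepSet (I : Set (Fin k × Fin 3))) : I.card ≤ k := by
  have hinj : Set.InjOn Prod.fst (I : Set (Fin k × Fin 3)) := fun x hx y hy hxy => by
    by_contra hne
    exact hI hx hy hne ⟨hxy, fun h => hne (Prod.ext hxy h)⟩
  have := Finset.card_le_card_of_injOn Prod.fst (fun x _ => Finset.mem_univ (x.1)) hinj
  simpa using this

theorem IsDisjointCycleCollection.three_mul_card_le {V : Type*} [Fintype V] {G : SimpleGraph V}
    {C : Finset G.Subgraph} (hC : G.IsDisjointCycleCollection C) :
    3 * C.card ≤ Fintype.card V := by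
  classical
  have h3 : ∀ H ∈ C, 3 ≤ H.verts.toFinset.card := fun H hH => by
    obtain ⟨v, p, hp, rfl⟩ := hC.1 H hH
    -- Dropping the first entry of the support removes the repetition of the base vertex.
    have hsub : p.support.tail.toFinset ⊆ p.toSubgraph.verts.toFinset := fun z hz => by
      simp only [List.mem_toFinset, Set.mem_toFinset, Walk.mem_verts_toSubgraph] at hz ⊢
      exact List.mem_of_mem_tail hz
    refine le_trans ?_ (Finset.card_le_card hsub)
    rw [List.toFinset_card_of_nodup hp.support_nodup]
    simpa using hp.three_le_length
  have hd : (C : Set G.Subgraph).PairwiseDisjoint fun H => H.verts.toFinset :=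
    fun H hH H' hH' hne => Set.disjoint_toFinset.2 (hC.2 hH hH' hne)
  calc 3 * C.card = ∑ _H ∈ C, 3 := by simp [mul_comm]
    _ ≤ ∑ H ∈ C, H.verts.toFinset.card := Finset.sum_le_sum h3
    _ = (C.biUnion fun H => H.verts.toFinset).card := (Finset.card_biUnion hd).symm
    _ ≤ Fintype.card V := Finset.card_le_univ _

/-- The point of the parabola `y = x ^ 2` with abscissa `t`. -/
def parabola (t : ℝ) : ℝ × ℝ := (t, t ^ 2)

theorem mem_segment_parabola {a b : ℝ} {z : ℝ × ℝ} (hz : z ∈ segment ℝ (parabola a) (parabola b)) :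
    z.1 ∈ Set.uIcc a b ∧ z.2 = (a + b) * z.1 - a * b := by
  obtain ⟨s, t, hs, ht, hst, rfl⟩ := hz
  refine ⟨?_, ?_⟩
  · rw [← segment_eq_uIcc]
    exact ⟨s, t, hs, ht, hst, by simp [parabola]⟩
  · obtain rfl : s = 1 - t := by linarith
    simp only [parabola, Prod.smul_mk, Prod.mk_add_mk, smul_eq_mul]
    ring

/-- On the chord, y - x² = (x - a)(b - x). The whole drawing thus lies on or above the parabola,
leaving the region below it to the outer face. -/
theorem sq_le_of_mem_segment_parabola {a b : ℝ} {z : ℝ × ℝ}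
    (hz : z ∈ segment ℝ (parabola a) (parabola b)) : z.1 ^ 2 ≤ z.2 := by
  obtain ⟨h1, h2⟩ := mem_segment_parabola hz
  rw [h2]
  rcases Set.mem_uIcc.1 h1 with ⟨h3, h4⟩ | ⟨h3, h4⟩ <;> nlinarith

/-- The abscissa of a vertex of the disjoint triangles. -/
def triangleAbscissa {k : ℕ} (v : Fin k × Fin 3) : ℝ := ((3 * v.1.val + v.2.val : ℕ) : ℝ)

theorem triangleAbscissa_injective {k : ℕ} :
    Function.Injective (triangleAbscissa : Fin k × Fin 3 → ℝ) := by
  rintro ⟨⟨i, hi⟩, ⟨j, hj⟩⟩ ⟨⟨i', hi'⟩, ⟨j', hj'⟩⟩ h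
  have h' : 3 * i + j = 3 * i' + j' := Nat.cast_injective h
  simp only [Prod.mk.injEq, Fin.mk.injEq]
  omega

/-- Triangle i occupies the abscissas from 3i to 3i + 2, and these intervals are disjoint, so edges
of different triangles cannot meet. -/
theorem fst_eq_of_mem_uIcc {k : ℕ} {u v x y : Fin k × Fin 3} (huv : u.1 = v.1) (hxy : x.1 = y.1)
    {t : ℝ} (h : t ∈ Set.uIcc (triangleAbscissa u) (triangleAbscissa v))
    (h' : t ∈ Set.uIcc (triangleAbscissa x) (triangleAbscissa y)) : u.1 = x.1 := by
  have hb : ∀ u v : Fin k × Fin 3, u.1 = v.1 →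
      t ∈ Set.uIcc (triangleAbscissa u) (triangleAbscissa v) →
      ((3 * u.1.val : ℕ) : ℝ) ≤ t ∧ t ≤ ((3 * u.1.val + 2 : ℕ) : ℝ) := by
    intro u v huv ht
    have hle : ∀ w : Fin k × Fin 3, w.1 = u.1 → ((3 * u.1.val : ℕ) : ℝ) ≤ triangleAbscissa w ∧
        triangleAbscissa w ≤ ((3 * u.1.val + 2 : ℕ) : ℝ) := fun w hw => by
      have := w.2.isLt
      constructor <;> (unfold triangleAbscissa; rw [hw]; gcongr; omega)
    obtain ⟨h1, h2⟩ := hle u rfl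
    obtain ⟨h3, h4⟩ := hle v huv.symm
    rcases Set.mem_uIcc.1 ht with ⟨h5, h6⟩ | ⟨h5, h6⟩ <;> constructor <;> linarith
  obtain ⟨h1, h2⟩ := hb u v huv h
  obtain ⟨h3, h4⟩ := hb x y hxy h'
  have h5 : 3 * u.1.val ≤ 3 * x.1.val + 2 := by exact_mod_cast h1.trans h4
  have h6 : 3 * x.1.val ≤ 3 * u.1.val + 2 := by exact_mod_cast h3.trans h2
  exact Fin.ext (by omega)

/-- The drawing of disjoint triangles with vertices on a parabola and straight edges. -/
noncomputable def disjointTrianglesDrawing (k : ℕ) : (disjointTriangles k).PlaneDrawing where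
  point v := parabola (triangleAbscissa v)
  arc := Sym2.lift ⟨fun u v => segment ℝ (parabola (triangleAbscissa u))
    (parabola (triangleAbscissa v)), fun _ _ => segment_symm ℝ _ _⟩
  point_injective u v h := triangleAbscissa_injective (congrArg Prod.fst h)
  isArc u v huv := by
    have hne : parabola (triangleAbscissa u) ≠ parabola (triangleAbscissa v) := fun h =>
      huv.2 (congrArg Prod.snd (triangleAbscissa_injective (congrArg Prod.fst h)))
    refine ⟨Path.segment _ _, ?_, ?_⟩
    · intro s t h
      exact Subtype.ext (AffineMap.lineMap_injective ℝ hne (by simpa using h))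
    · simp
  mem_of_point_mem_arc e he w hw := by
    induction e using Sym2.ind with
    | _ u v =>
      rw [Sym2.lift_mk] at hw
      have h2 := (mem_segment_parabola hw).2
      simp only [parabola] at h2
      have : (triangleAbscissa w - triangleAbscissa u) *
          (triangleAbscissa w - triangleAbscissa v) = 0 := by linear_combination h2
      rcases mul_eq_zero.1 this with h | h
      · rw [triangleAbscissa_injective (sub_eq_zero.1 h)]; exact Sym2.mem_mk_left _ _
      · rw [triangleAbscissa_injective (sub_eq_zero.1 h)]; exact Sym2.mem_mk_right _ _
  arc_inter_arc e he f hf hef z hz := by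
    -- The equations of two chords from the same end a differ by (b - c)(x - a), which vanishes only
    -- at x = a.
    have hcommon : ∀ a b c : Fin k × Fin 3, b ≠ c →
        z ∈ segment ℝ (parabola (triangleAbscissa a)) (parabola (triangleAbscissa b)) →
        z ∈ segment ℝ (parabola (triangleAbscissa a)) (parabola (triangleAbscissa c)) →
        z = parabola (triangleAbscissa a) := by
      intro a b c hbc hb hc
      have h1 := (mem_segment_parabola hb).2
      have h2 := (mem_segment_parabola hc).2
      have h3 : (triangleAbscissa b - triangleAbscissa c) * (z.1 - triangleAbscissa a) = 0 := by
        linear_combination h2 - h1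
      have h4 : z.1 = triangleAbscissa a := sub_eq_zero.1 ((mul_eq_zero.1 h3).resolve_left
        (sub_ne_zero.2 fun h => hbc (triangleAbscissa_injective h)))
      refine Prod.ext h4 ?_
      rw [h1, h4]
      simp only [parabola]; ring
    induction e using Sym2.ind with
    | _ u v =>
    induction f using Sym2.ind with
    | _ x y =>
    rw [Sym2.lift_mk, Sym2.lift_mk] at hz
    obtain ⟨hz1, hz2⟩ := hz
    have huv : u.1 = v.1 ∧ u.2 ≠ v.2 := he
    have hxy : x.1 = y.1 ∧ x.2 ≠ y.2 := hf
    have hux : u.1 = x.1 := fst_eq_of_mem_uIcc huv.1 hxy.1 (mem_segment_parabola hz1).1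
      (mem_segment_parabola hz2).1
    have hz1' : z ∈ segment ℝ (parabola (triangleAbscissa v)) (parabola (triangleAbscissa u)) :=
      segment_symm ℝ (parabola (triangleAbscissa u)) _ ▸ hz1
    have hz2' : z ∈ segment ℝ (parabola (triangleAbscissa y)) (parabola (triangleAbscissa x)) :=
      segment_symm ℝ (parabola (triangleAbscissa x)) _ ▸ hz2
    -- Two edges of one triangle always share a vertex, since two pairs among three elements meet.
    have key : u = x ∨ u = y ∨ v = x ∨ v = y := by
      have : u.2 = x.2 ∨ u.2 = y.2 ∨ v.2 = x.2 ∨ v.2 = y.2 := by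
        have h1 := huv.2
        have h2 := hxy.2
        omega
      rcases this with h | h | h | h
      · exact Or.inl (Prod.ext hux h)
      · exact Or.inr (Or.inl (Prod.ext (hux.trans hxy.1) h))
      · exact Or.inr (Or.inr (Or.inl (Prod.ext (huv.1.symm.trans hux) h)))
      · exact Or.inr (Or.inr (Or.inr (Prod.ext (huv.1.symm.trans (hux.trans hxy.1)) h)))
    rcases key with rfl | rfl | rfl | rfl
    · exact ⟨u, by simp, by simp, hcommon u v y (fun h => hef (h ▸ rfl)) hz1 hz2⟩
    · exact ⟨u, by simp, by simp, hcommon u v x (fun h => hef (h ▸ Sym2.eq_swap)) hz1 hz2'⟩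
    · exact ⟨v, by simp, by simp, hcommon v u y (fun h => hef (h ▸ Sym2.eq_swap)) hz1' hz2⟩
    · exact ⟨v, by simp, by simp, hcommon v u x (fun h => hef (h ▸ rfl)) hz1' hz2'⟩

theorem sq_le_of_mem_carrier_disjointTrianglesDrawing {k : ℕ} {z : ℝ × ℝ}
    (hz : z ∈ (disjointTrianglesDrawing k).carrier) : z.1 ^ 2 ≤ z.2 := by
  rcases hz with ⟨v, rfl⟩ | hz
  · exact le_rfl
  · obtain ⟨e, he, hz⟩ := Set.mem_iUnion₂.1 hz
    induction e using Sym2.ind with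
    | _ u v => exact sq_le_of_mem_segment_parabola hz

theorem isOuterplanar_disjointTriangles (k : ℕ) : (disjointTriangles k).IsOuterplanar := by
  refine ⟨disjointTrianglesDrawing k, fun v => ?_⟩
  set D := disjointTrianglesDrawing k with hD
  set a := triangleAbscissa v with ha
  have hpt : D.point v = (a, a ^ 2) := rfl
  -- The vertical ray below the vertex avoids the drawing and is unbounded, so it lies in the outer
  -- face and accumulates at the vertex.
  let g : ℝ → ℝ × ℝ := fun t => (a, a ^ 2 - t)
  have hg : Continuous g := by fun_prop
  have hsub : g '' Set.Ioi 0 ⊆ D.carrierᶜ := by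
    rintro _ ⟨t, ht, rfl⟩ hz
    have h1 : a ^ 2 ≤ a ^ 2 - t := sq_le_of_mem_carrier_disjointTrianglesDrawing hz
    have h2 : 0 < t := ht
    linarith
  have hface : ∀ t > 0, g t ∈ D.outerFace := fun t ht => by
    refine ⟨hsub ⟨t, ht, rfl⟩, fun hb => ?_⟩
    have hsub' := (isPreconnected_Ioi.image g hg.continuousOn).subset_connectedComponentIn
      (Set.mem_image_of_mem g ht) hsub
    obtain ⟨M, hM⟩ := (hb.subset hsub').exists_norm_le
    have h1 := hM (g (|a ^ 2| + |M| + 1)) ⟨_, by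
      have := abs_nonneg (a ^ 2)
      have := abs_nonneg M
      simp only [Set.mem_Ioi]; linarith, rfl⟩
    have h2 : ‖a ^ 2 - (|a ^ 2| + |M| + 1)‖ ≤ M := (norm_snd_le (g _)).trans h1
    rw [Real.norm_eq_abs] at h2
    have h3 := neg_le_abs (a ^ 2 - (|a ^ 2| + |M| + 1))
    have h4 := le_abs_self (a ^ 2)
    have h5 := le_abs_self M
    linarith
  rw [frontier_eq_closure_inter_closure]
  refine ⟨?_, subset_closure fun h => h.1 (Or.inl ⟨v, rfl⟩)⟩
  have hlim : Filter.Tendsto g (nhdsWithin 0 (Set.Ioi 0)) (nhds (D.point v)) := by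
    have := (hg.tendsto 0).mono_left (nhdsWithin_le_nhds (s := Set.Ioi (0 : ℝ)))
    simpa [g, hpt] using this
  exact mem_closure_of_tendsto hlim (Filter.eventually_of_mem self_mem_nhdsWithin hface)

end SimpleGraph

theorem mainTheorem3 :
    (∀ (V : Type*) [Fintype V] (G : SimpleGraph V), G.IsOuterplanar →
      ∃ (I : Finset V) (C : Finset G.Subgraph),
        G.IsIndepSet (I : Set V) ∧ G.IsDisjointCycleCollection C ∧
          9 * (I.card : ℤ) ≥ 4 * (Fintype.card V : ℤ) - 3 * (C.card : ℤ)) ∧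
    (∀ k : ℕ, (SimpleGraph.disjointTriangles k).IsOuterplanar ∧
      ∀ (I : Finset (Fin k × Fin 3)) (C : Finset (SimpleGraph.disjointTriangles k).Subgraph),
        (SimpleGraph.disjointTriangles k).IsIndepSet (I : Set (Fin k × Fin 3)) →
        (SimpleGraph.disjointTriangles k).IsDisjointCycleCollection C →
          9 * (I.card : ℤ) ≤ 4 * (Fintype.card (Fin k × Fin 3) : ℤ) - 3 * (C.card : ℤ)) := by
  refine ⟨fun V _ G ⟨D, hD⟩ => ?_, fun k =>
    ⟨SimpleGraph.isOuterplanar_disjointTriangles k, fun I C hI hC => ?_⟩⟩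
  · obtain ⟨D'⟩ := D.nonempty_coneDrawing hD
    obtain ⟨I, C, -, hI, hC, hd, hb⟩ := D'.exists_indepSet_and_cores
    obtain ⟨C', hC', hcard⟩ :=
      SimpleGraph.exists_isDisjointCycleCollection (fun B hB => (hC B hB).2) hd
    refine ⟨I, C', hI, hC', ?_⟩
    rw [Finset.card_univ] at hb
    omega
  · have h1 := SimpleGraph.card_le_of_isIndepSet_disjointTriangles hI
    have h2 := hC.three_mul_card_le
    have h3 : Fintype.card (Fin k × Fin 3) = k * 3 := by simp
    omega
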